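/- Let $d\ge 1$, let $1<r<\infty$, let $\alpha\in\mathbb R$, and let $\mathbb K$ be $\mathbb R$ or $\mathbb C$. Cubes $Q\subset\mathbb R^d$ have sides parallel to the axes, $|Q|$ is Lebesgue measure and $\langle g\rangle_Q=\frac1{|Q|}\int_Q g\,dx$. A weight is a locally integrable, almost everywhere positive function $w$ on $\mathbb R^d$; it belongs to $A_r$ if $$[w]_{A_r}:=\sup_Q\,\langle w\rangle_Q\,\langle w^{-1/(r-1)}\rangle_Q^{\,r-1}<\infty .$$ For a weight $w$, $L^r(w)$ is the space of measurable $f:\mathbb R^d\to\mathbb K$ (modulo almost everywhere equality) with $\|f\|_{L^r(w)}:=\left(\int_{\mathbb R^d}|f|^r\,w\,dx\right)^{1/r}<\infty$. A locally integrable function $b:\mathbb R^d\to\mathbb K$ belongs to $\mathrm{BMO}$ if $\|b\|_{\mathrm{BMO}}:=\sup_Q\langle |b-\langle b\rangle_Q|\rangle_Q<\infty$. **Theorem (quantitative transference).** Let $T$ be a $\mathbb K$-linear operator whose domain is a linear space of measurable functions $\mathbb R^d\to\mathbb K$ (modulo almost everywhere equality) containing $L^r(w)$ for every $w\in A_r$,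 and whose values are such functions. Suppose that there is a constant $C_0<\infty$ such that $$\|Tf\|_{L^r(w)}\le C_0\,[w]_{A_r}^{\alpha}\,\|f\|_{L^r(w)}\qquad\text{for all } w\in A_r,\ f\in L^r(w).$$ Then there is a constant $C<\infty$ (depending on $r$, $d$, $\alpha$ and $T$ only) such that, for every $b\in\mathrm{BMO}$, every $w\in A_r$ and every $f\in L^r(w)$, the function $bf$ lies in the domain of $T$, so that the commutator $[b,T]f:=b\,Tf-T(bf)$ is defined, and $$\|[b,T]f\|_{L^r(w)}\le C\,[w]_{A_r}^{\alpha+\max\{1,\frac1{r-1}\}}\,\|b\|_{\mathrm{BMO}}\,\|f\|_{L^r(w)} .$$ -/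

import Mathlib

open MeasureTheory
open scoped ENNReal NNReal

noncomputable section

/-- The cube in `ℝ^d` with sides parallel to the axes, lower corner `a` and side length `ℓ`.
Points of `ℝ^d` are functions `Fin d → ℝ`, with Lebesgue measure `volume`. -/
def axisCube {d : ℕ} (a : Fin d → ℝ) (ℓ : ℝ) : Set (Fin d → ℝ) :=
  Set.Icc a (fun i => a i + ℓ)

/-- A weight on `ℝ^d`: a locally integrable, almost everywhere positive function. -/
def IsWeight {d : ℕ} (w : (Fin d → ℝ) → ℝ) : Prop :=
  LocallyIntegrable w volume ∧ ∀ᵐ x ∂(volume : Measure (Fin d → ℝ)), 0 < w x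

/-- The Muckenhoupt characteristic
`[w]_{A_r} = sup_Q ⟨w⟩_Q ⟨w^{-1/(r-1)}⟩_Q^{r-1}`, the supremum being over all cubes. -/
def muckenhouptChar {d : ℕ} (r : ℝ) (w : (Fin d → ℝ) → ℝ) : ℝ≥0∞ :=
  ⨆ (a : Fin d → ℝ) (ℓ : ℝ) (_ : 0 < ℓ),
    (⨍⁻ x in axisCube a ℓ, ENNReal.ofReal (w x) ∂volume) *
      (⨍⁻ x in axisCube a ℓ, ENNReal.ofReal (w x ^ (-1 / (r - 1))) ∂volume) ^ (r - 1)

/-- The Muckenhoupt class `A_r`. -/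
def IsMuckenhoupt {d : ℕ} (r : ℝ) (w : (Fin d → ℝ) → ℝ) : Prop :=
  IsWeight w ∧ muckenhouptChar r w < ∞

/-- The norm `‖f‖_{L^r(w)} = (∫ |f|^r w dx)^{1/r}`, with value `∞` when `f ∉ L^r(w)`. -/
def weightedNorm {d : ℕ} {𝕜 : Type*} [RCLike 𝕜] (r : ℝ) (w : (Fin d → ℝ) → ℝ)
    (f : (Fin d → ℝ) →ₘ[volume] 𝕜) : ℝ≥0∞ :=
  eLpNorm f (ENNReal.ofReal r) (volume.withDensity fun x => ENNReal.ofReal (w x))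

/-- `‖b‖_BMO = sup_Q ⟨|b - ⟨b⟩_Q|⟩_Q`, the supremum being over all cubes. -/
def bmoNorm {d : ℕ} {𝕜 : Type*} [RCLike 𝕜] (b : (Fin d → ℝ) →ₘ[volume] 𝕜) : ℝ≥0∞ :=
  ⨆ (a : Fin d → ℝ) (ℓ : ℝ) (_ : 0 < ℓ),
    ⨍⁻ x in axisCube a ℓ, ‖b x - ⨍ y in axisCube a ℓ, b y ∂volume‖ₑ ∂volume

/-- Bounded mean oscillation. -/
def IsBMO {d : ℕ} {𝕜 : Type*} [RCLike 𝕜] (b : (Fin d → ℝ) →ₘ[volume] 𝕜) : Prop :=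
  LocallyIntegrable b volume ∧ bmoNorm b < ∞

/-- Multiplication by `b`, as a linear map on measurable functions modulo a.e. equality. -/
def mulOperator {d : ℕ} {𝕜 : Type*} [RCLike 𝕜] (b : (Fin d → ℝ) →ₘ[volume] 𝕜) :
    ((Fin d → ℝ) →ₘ[volume] 𝕜) →ₗ[𝕜] ((Fin d → ℝ) →ₘ[volume] 𝕜) where
  toFun f := b * f
  map_add' f g := by
    refine AEEqFun.induction_on₃ b f g fun b hb f hf g hg => ?_
    simp only [AEEqFun.mk_add_mk, AEEqFun.mk_mul_mk, mul_add]
  map_smul' c f := by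
    refine AEEqFun.induction_on₂ b f fun b hb f hf => ?_
    simp only [AEEqFun.smul_mk, AEEqFun.mk_mul_mk, mul_smul_comm, RingHom.id_apply]

/-- The commutator `[b, T] f = b (T f) - T (b f)` of a linear operator `T` with domain `T.domain`
and multiplication by `b`, on its natural domain: all `f` with `f` and `b f` in `T.domain`.
Functions are identified when they agree almost everywhere. -/
def mulCommutator {d : ℕ} {𝕜 : Type*} [RCLike 𝕜] (b : (Fin d → ℝ) →ₘ[volume] 𝕜)
    (T : ((Fin d → ℝ) →ₘ[volume] 𝕜) →ₗ.[𝕜] ((Fin d → ℝ) →ₘ[volume] 𝕜)) :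
    ((Fin d → ℝ) →ₘ[volume] 𝕜) →ₗ.[𝕜] ((Fin d → ℝ) →ₘ[volume] 𝕜) where
  domain := T.domain ⊓ T.domain.comap (mulOperator b)
  toFun :=
    mulOperator b ∘ₗ T.toFun ∘ₗ Submodule.inclusion inf_le_left -
      T.toFun ∘ₗ (mulOperator b).restrict
        (fun _ hf => (Submodule.mem_inf.1 hf).2 :
          ∀ f ∈ T.domain ⊓ T.domain.comap (mulOperator b), mulOperator b f ∈ T.domain)

/-- For every `w ∈ A_r`, the operator `S` is defined on all of `L^r(w)`, and
`‖S f‖_{L^r(w)} ≤ K [w]_{A_r}^β ‖f‖_{L^r(w)}` for all `f ∈ L^r(w)`. -/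
def HasMuckenhouptBound {d : ℕ} {𝕜 : Type*} [RCLike 𝕜]
    (S : ((Fin d → ℝ) →ₘ[volume] 𝕜) →ₗ.[𝕜] ((Fin d → ℝ) →ₘ[volume] 𝕜))
    (r β : ℝ) (K : ℝ≥0∞) : Prop :=
  ∀ w : (Fin d → ℝ) → ℝ, IsMuckenhoupt r w →
    ∀ f : (Fin d → ℝ) →ₘ[volume] 𝕜, weightedNorm r w f < ∞ →
      ∃ hf : f ∈ S.domain,
        weightedNorm r w (S ⟨f, hf⟩) ≤ K * muckenhouptChar r w ^ β * weightedNorm r w f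

end

/-! The proof conjugates `T` by exponentials of the symbol. For a real bounded symbol `b`, the
derivative at `z = 0` of `z ↦ e^{zb} T (e^{-zb} f)` is `[b, T] f`, so Cauchy's estimate on the
circle `|z| = ε` bounds the commutator by `1/ε` times the supremum of the conjugated operators.
Multiplication by `e^{zb}` turns the weight `w` into `e^{r Re z b} w`, so the conjugated operator is
controlled by `T` on the perturbed space, where the hypothesis applies as long as the perturbed
weight is still in `A_r` with characteristic comparable to `[w]`. This holds for `ε ‖b‖ ≲
[w]^{-max(1, 1/(r-1))}`, and `1/ε` is the source of the extra power
(`HasMuckenhouptBound.clamp_commutator_le`).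

The admissible size of `ε` comes from a John–Nirenberg inequality for the measures `w dx` and
`w^{-1/(r-1)} dx` (`lintegral_exp_osc_le`). It only needs that a set filling half of a cube carries
a fixed proportion `η` of its mass; Hölder's inequality and the `A_r` condition give `η = (2^r
[w])^{-max(1, 1/(r-1))}` for both measures. In the product defining the characteristic, the
exponentials of the mean of `b` cancel (`IsMuckenhoupt.exp_mul`).

Scalars may be real, so complex exponentials are used only on the symbol side: `(p, q) ↦ p(b) T
(q(b) f)` is a real bilinear map on continuous functions on `[-N, N]`, and after composition with a
functional it extends to complex functions (`norm_bilin_commutator_le`). For an unbounded symbol, `b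
f` lies only in spaces with damped weight `e^{-δ|b|} w`, still in `A_r` for small `δ`. There the
truncation error tends to zero as `N → ∞`, while the commutator bound does not depend on `N` or `δ`;
then `δ → 0` (`HasMuckenhouptBound.real_commutator_le`). General symbols split into real and
imaginary parts. -/

noncomputable section

/-! ### Cubes, dyadic subcubes and the Calderón–Zygmund decomposition -/

/-- The half-open cube with lower corner `a` and side length `ℓ`. -/
def halfOpenCube {d : ℕ} (a : Fin d → ℝ) (ℓ : ℝ) : Set (Fin d → ℝ) :=
  Set.univ.pi fun i => Set.Ico (a i) (a i + ℓ)

variable {d : ℕ}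

theorem mem_halfOpenCube {a x : Fin d → ℝ} {ℓ : ℝ} :
    x ∈ halfOpenCube a ℓ ↔ ∀ i, a i ≤ x i ∧ x i < a i + ℓ := by
  simp [halfOpenCube, Set.mem_pi]

theorem measurableSet_halfOpenCube (a : Fin d → ℝ) (ℓ : ℝ) :
    MeasurableSet (halfOpenCube a ℓ) :=
  MeasurableSet.univ_pi fun _ => measurableSet_Ico

theorem halfOpenCube_ae_eq (a : Fin d → ℝ) (ℓ : ℝ) :
    halfOpenCube a ℓ =ᵐ[volume] axisCube a ℓ :=
  Measure.univ_pi_Ico_ae_eq_Icc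

theorem halfOpenCube_subset_axisCube (a : Fin d → ℝ) (ℓ : ℝ) :
    halfOpenCube a ℓ ⊆ axisCube a ℓ := fun _ hx =>
  ⟨fun i => (mem_halfOpenCube.1 hx i).1, fun i => (mem_halfOpenCube.1 hx i).2.le⟩

theorem isCompact_axisCube (a : Fin d → ℝ) (ℓ : ℝ) : IsCompact (axisCube a ℓ) := isCompact_Icc

theorem volume_axisCube (a : Fin d → ℝ) (ℓ : ℝ) :
    volume (axisCube a ℓ) = ENNReal.ofReal ℓ ^ d := by
  simp [axisCube, Real.volume_Icc_pi]

theorem volume_halfOpenCube (a : Fin d → ℝ) (ℓ : ℝ) :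
    volume (halfOpenCube a ℓ) = ENNReal.ofReal ℓ ^ d := by
  rw [measure_congr (halfOpenCube_ae_eq a ℓ), volume_axisCube]

theorem volumeReal_halfOpenCube (a : Fin d → ℝ) {ℓ : ℝ} (hℓ : 0 < ℓ) :
    volume.real (halfOpenCube a ℓ) = ℓ ^ d := by
  simp [Measure.real, volume_halfOpenCube, hℓ.le]

theorem integrableOn_halfOpenCube {E : Type*} [NormedAddCommGroup E] {g : (Fin d → ℝ) → E}
    (hg : LocallyIntegrable g volume) (a : Fin d → ℝ) (ℓ : ℝ) :
    IntegrableOn g (halfOpenCube a ℓ) :=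
  (hg.integrableOn_isCompact (isCompact_axisCube a ℓ)).mono_set (halfOpenCube_subset_axisCube a ℓ)

/-- The lower corner of the dyadic subcube of generation `k` of the cube `(a, ℓ)` (or of one of its
translates) that contains `x`. -/
def dyadicCorner (a : Fin d → ℝ) (ℓ : ℝ) (k : ℕ) (x : Fin d → ℝ) : Fin d → ℝ :=
  fun i => a i + ⌊(x i - a i) / (ℓ / 2 ^ k)⌋ * (ℓ / 2 ^ k)

/-- The dyadic subcube of generation `k` that contains `x`. -/
def dyadicCube (a : Fin d → ℝ) (ℓ : ℝ) (k : ℕ) (x : Fin d → ℝ) : Set (Fin d → ℝ) :=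
  halfOpenCube (dyadicCorner a ℓ k x) (ℓ / 2 ^ k)

section Dyadic

variable {a x y : Fin d → ℝ} {ℓ : ℝ} {k : ℕ}

/-- Integer indices make "lying in the same cube of generation `k`" visibly an equivalence relation;
nesting and disjointness of dyadic cubes are read off from it. -/
theorem mem_dyadicCube (hℓ : 0 < ℓ) : y ∈ dyadicCube a ℓ k x ↔
    ∀ i, ⌊(y i - a i) / (ℓ / 2 ^ k)⌋ = ⌊(x i - a i) / (ℓ / 2 ^ k)⌋ := by
  have h : 0 < ℓ / 2 ^ k := by positivity
  simp only [dyadicCube, mem_halfOpenCube, dyadicCorner, Int.floor_eq_iff]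
  refine forall_congr' fun i => ?_
  rw [le_div_iff₀ h, div_lt_iff₀ h, add_mul, one_mul]
  constructor <;> rintro ⟨h1, h2⟩ <;> constructor <;> linarith

theorem mem_dyadicCube_self (hℓ : 0 < ℓ) : x ∈ dyadicCube a ℓ k x :=
  (mem_dyadicCube hℓ).2 fun _ => rfl

theorem dyadicCorner_eq_of_mem (hℓ : 0 < ℓ) (h : y ∈ dyadicCube a ℓ k x) :
    dyadicCorner a ℓ k y = dyadicCorner a ℓ k x := by
  funext i
  simp only [dyadicCorner, (mem_dyadicCube hℓ).1 h i]

theorem dyadicCube_eq_of_mem (hℓ : 0 < ℓ) (h : y ∈ dyadicCube a ℓ k x) :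
    dyadicCube a ℓ k y = dyadicCube a ℓ k x := by
  rw [dyadicCube, dyadicCorner_eq_of_mem hℓ h, dyadicCube]

theorem dyadicCube_succ_subset (hℓ : 0 < ℓ) :
    dyadicCube a ℓ (k + 1) x ⊆ dyadicCube a ℓ k x := by
  intro y hy
  rw [mem_dyadicCube hℓ] at hy ⊢
  intro i
  -- The index of the parent is the integer half of the index of the child.
  have key : ∀ t : ℝ, ⌊t / (ℓ / 2 ^ k)⌋ = ⌊t / (ℓ / 2 ^ (k + 1))⌋ / 2 := by
    intro t
    have := Int.floor_div_natCast (t / (ℓ / 2 ^ (k + 1))) 2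
    rw [show ((2 : ℕ) : ℤ) = 2 from rfl] at this
    rw [← this]
    congr 1
    field_simp
    push_cast; ring
  rw [key, key, hy i]

theorem dyadicCube_antitone (hℓ : 0 < ℓ) : Antitone fun k => dyadicCube a ℓ k x :=
  antitone_nat_of_succ_le fun _ => dyadicCube_succ_subset hℓ

theorem dyadicCube_zero (hℓ : 0 < ℓ) (hx : x ∈ halfOpenCube a ℓ) :
    dyadicCube a ℓ 0 x = halfOpenCube a ℓ := by
  have : dyadicCorner a ℓ 0 x = a := by
    funext i
    have h := mem_halfOpenCube.1 hx i
    have : ⌊(x i - a i) / (ℓ / 2 ^ 0)⌋ = 0 := by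
      rw [Int.floor_eq_zero_iff]
      constructor
      · have := h.1
        exact div_nonneg (by linarith) (by positivity)
      · rw [pow_zero, div_one, div_lt_one hℓ]; linarith [h.2]
    simp only [dyadicCorner, this]; simp
  rw [dyadicCube, this]; simp

theorem countable_dyadicCorner (a : Fin d → ℝ) (ℓ : ℝ) :
    {p : (Fin d → ℝ) × ℝ | ∃ k x, p = (dyadicCorner a ℓ k x, ℓ / 2 ^ k)}.Countable := by
  refine (Set.countable_range fun q : ℕ × (Fin d → ℤ) =>
    ((fun i => a i + q.2 i * (ℓ / 2 ^ q.1) : Fin d → ℝ), ℓ / 2 ^ q.1)).mono ?_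
  rintro p ⟨k, x, rfl⟩
  exact ⟨(k, fun i => ⌊(x i - a i) / (ℓ / 2 ^ k)⌋), rfl⟩

theorem axisCube_eq_closedBall (a : Fin d → ℝ) {ℓ : ℝ} (hℓ : 0 < ℓ) :
    axisCube a ℓ = Metric.closedBall (fun i => a i + ℓ / 2) (ℓ / 2) := by
  rw [closedBall_pi _ (by positivity), axisCube, ← Set.pi_univ_Icc]
  simp only [Real.closedBall_eq_Icc]
  congr! 3 <;> ring

/-- Cubes are sup-norm balls up to null sets, so this is Lebesgue differentiation along balls that
contain `x` without being centred there (dilation factor `1`). -/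
theorem ae_tendsto_dyadicAverage {g : (Fin d → ℝ) → ℝ} (hg : LocallyIntegrable g volume)
    (a : Fin d → ℝ) {ℓ : ℝ} (hℓ : 0 < ℓ) :
    ∀ᵐ x, Filter.Tendsto (fun k => ⨍ y in dyadicCube a ℓ k x, g y) Filter.atTop (nhds (g x)) := by
  filter_upwards [IsUnifLocDoublingMeasure.ae_tendsto_average volume hg 1] with x hx
  have h := @hx ℕ Filter.atTop (fun k i => dyadicCorner a ℓ k x i + ℓ / 2 ^ k / 2)
    (fun k => ℓ / 2 ^ k / 2) ?_ ?_
  · refine h.congr fun k => ?_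
    rw [← axisCube_eq_closedBall _ (by positivity)]
    exact setAverage_congr (halfOpenCube_ae_eq _ _).symm
  · refine tendsto_nhdsWithin_iff.2 ⟨?_, Filter.Eventually.of_forall fun k => ?_⟩
    · have := (tendsto_pow_atTop_nhds_zero_of_lt_one (r := (1 / 2 : ℝ)) (by norm_num)
        (by norm_num)).const_mul (ℓ / 2)
      rw [mul_zero] at this
      refine this.congr fun k => ?_
      rw [one_div_pow]; ring
    · exact Set.mem_Ioi.2 (by positivity)
  · refine Filter.Eventually.of_forall fun k => ?_
    rw [one_mul, ← axisCube_eq_closedBall _ (by positivity)]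
    exact halfOpenCube_subset_axisCube _ _ (mem_dyadicCube_self hℓ)

/-- The Calderón–Zygmund decomposition of a cube at height `c`. -/
theorem exists_calderonZygmund {g : (Fin d → ℝ) → ℝ} (hg0 : ∀ x, 0 ≤ g x)
    (hg : LocallyIntegrable g volume) (a : Fin d → ℝ) {ℓ : ℝ} (hℓ : 0 < ℓ) {c : ℝ}
    (hc : ∫ x in halfOpenCube a ℓ, g x ≤ c * ℓ ^ d) :
    ∃ J : Set ((Fin d → ℝ) × ℝ), J.Countable ∧
      (∀ p ∈ J, 0 < p.2 ∧ halfOpenCube p.1 p.2 ⊆ halfOpenCube a ℓ ∧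
        c * p.2 ^ d < ∫ x in halfOpenCube p.1 p.2, g x ∧
        ∫ x in halfOpenCube p.1 p.2, g x ≤ 2 ^ d * c * p.2 ^ d) ∧
      J.PairwiseDisjoint (fun p => halfOpenCube p.1 p.2) ∧
      ∀ᵐ x, x ∈ halfOpenCube a ℓ → x ∉ ⋃ p ∈ J, halfOpenCube p.1 p.2 → g x ≤ c := by
  -- A stopping-time argument: a cube is selected at the first generation where the average exceeds
  -- `c`. This depends only on the cube and not on the point `x` in it, which makes selected cubes
  -- disjoint.
  let bad : ℕ → (Fin d → ℝ) → Prop := fun k x =>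
    c * (ℓ / 2 ^ k) ^ d < ∫ y in dyadicCube a ℓ k x, g y
  have bad_congr : ∀ {k j x y}, y ∈ dyadicCube a ℓ k x → j ≤ k → (bad j y ↔ bad j x) := by
    intro k j x y hy hj
    simp only [bad]
    rw [dyadicCube_eq_of_mem hℓ (dyadicCube_antitone hℓ hj hy)]
  let first : ℕ → (Fin d → ℝ) → Prop := fun k x => bad k x ∧ ∀ j < k, ¬ bad j x
  have first_congr : ∀ {k x y}, y ∈ dyadicCube a ℓ k x → (first k y ↔ first k x) := by
    intro k x y hy
    simp only [first]
    rw [bad_congr hy le_rfl]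
    refine and_congr_right fun _ => forall₂_congr fun j hj => ?_
    rw [bad_congr hy hj.le]
  have first_unique : ∀ {k j x}, first k x → first j x → k = j := by
    intro k j x h1 h2
    rcases lt_trichotomy k j with h | h | h
    · exact absurd h1.1 (h2.2 k h)
    · exact h
    · exact absurd h2.1 (h1.2 j h)
  refine ⟨{p | ∃ k x, x ∈ halfOpenCube a ℓ ∧ first k x ∧
    p = (dyadicCorner a ℓ k x, ℓ / 2 ^ k)}, ?_, ?_, ?_, ?_⟩
  · refine (countable_dyadicCorner a ℓ).mono ?_
    rintro p ⟨k, x, _, _, h⟩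
    exact ⟨k, x, h⟩
  · rintro p ⟨k, x, hx, hf, rfl⟩
    have h0 : k ≠ 0 := by
      rintro rfl
      have := hf.1
      simp only [bad, dyadicCube_zero hℓ hx, pow_zero, div_one] at this
      exact absurd hc (not_le.2 this)
    obtain ⟨k, rfl⟩ : ∃ j, k = j + 1 := ⟨k - 1, by omega⟩
    refine ⟨by positivity, ?_, hf.1, ?_⟩
    · rw [← dyadicCube_zero hℓ hx]
      exact dyadicCube_antitone hℓ (Nat.zero_le _)
    -- The parent was not bad, and its volume is `2 ^ d` times larger.
    · have h1 := not_lt.1 (hf.2 k k.lt_succ_self)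
      have h2 : ∫ y in dyadicCube a ℓ (k + 1) x, g y ≤ ∫ y in dyadicCube a ℓ k x, g y :=
        setIntegral_mono_set (integrableOn_halfOpenCube hg _ _)
          (Filter.Eventually.of_forall hg0)
          (Filter.Eventually.of_forall (dyadicCube_succ_subset hℓ))
      refine (h2.trans h1).trans (le_of_eq ?_)
      have : ℓ / 2 ^ k = 2 * (ℓ / 2 ^ (k + 1)) := by field_simp; ring
      rw [this, mul_pow]
      ring
  · rintro p ⟨k, x, hx, hf, rfl⟩ q ⟨j, y, hy, hf', rfl⟩ hne
    refine Set.disjoint_left.2 fun z hz hz' => hne ?_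
    have hz : z ∈ dyadicCube a ℓ k x := hz
    have hz' : z ∈ dyadicCube a ℓ j y := hz'
    obtain rfl := first_unique ((first_congr hz).2 hf) ((first_congr hz').2 hf')
    rw [← dyadicCorner_eq_of_mem hℓ hz, ← dyadicCorner_eq_of_mem hℓ hz']
  · filter_upwards [ae_tendsto_dyadicAverage hg a hℓ] with x hx hxQ hxJ
    -- A point outside the selected cubes has no bad generation, since the first one would have been
    -- selected.
    have hgood : ∀ k, ¬ bad k x := by
      intro k
      induction k using Nat.strong_induction_on with
      | _ k ih =>
        intro hb
        exact hxJ (Set.mem_biUnion (x := (dyadicCorner a ℓ k x, ℓ / 2 ^ k))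
          ⟨k, x, hxQ, ⟨hb, ih⟩, rfl⟩ (mem_dyadicCube_self hℓ))
    refine le_of_tendsto' hx fun k => ?_
    rw [setAverage_eq, dyadicCube, volumeReal_halfOpenCube _ (by positivity), smul_eq_mul,
      inv_mul_le_iff₀ (by positivity), mul_comm _ c]
    exact not_lt.1 (hgood k)

end Dyadic
end

/-! ### Weighted John–Nirenberg inequality: the iteration -/

noncomputable section
variable {d : ℕ}

/-- `β` is locally integrable with mean oscillation at most `B` on all cubes. -/
def HasOscBound (β : (Fin d → ℝ) → ℝ) (B : ℝ) : Prop :=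
  LocallyIntegrable β volume ∧ ∀ (a : Fin d → ℝ) (ℓ : ℝ), 0 < ℓ →
    ∫ x in halfOpenCube a ℓ, |β x - ⨍ y in halfOpenCube a ℓ, β y| ≤ B * ℓ ^ d

/-- The measure `μ` is finite on cubes and charges every subset that fills half of a cube with at
least the proportion `η` of the mass of the cube. -/
def HasHalfProportion (μ : Measure (Fin d → ℝ)) (η : ℝ) : Prop :=
  ∀ (a : Fin d → ℝ) (ℓ : ℝ), 0 < ℓ → μ (halfOpenCube a ℓ) ≠ ∞ ∧
    ∀ E ⊆ halfOpenCube a ℓ, MeasurableSet E → 1 / 2 * ℓ ^ d ≤ volume.real E →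
      η * μ.real (halfOpenCube a ℓ) ≤ μ.real E

theorem locallyIntegrable_abs_sub {β : (Fin d → ℝ) → ℝ} (hβ : LocallyIntegrable β volume) (c : ℝ) :
    LocallyIntegrable (fun x => |β x - c|) volume :=
  fun x => ((hβ.sub (locallyIntegrable_const c)) x).norm

theorem abs_average_sub_le {β : (Fin d → ℝ) → ℝ} (hβ : LocallyIntegrable β volume) (c : ℝ)
    (a : Fin d → ℝ) {ℓ : ℝ} (hℓ : 0 < ℓ) :
    |(⨍ y in halfOpenCube a ℓ, β y) - c| * ℓ ^ d ≤ ∫ y in halfOpenCube a ℓ, |β y - c| := by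
  have hfin : volume (halfOpenCube a ℓ) ≠ ∞ := by simp [volume_halfOpenCube]
  have h1 : ∫ y in halfOpenCube a ℓ, (β y - c) =
      ((⨍ y in halfOpenCube a ℓ, β y) - c) * ℓ ^ d := by
    rw [integral_sub (integrableOn_halfOpenCube hβ a ℓ) (integrableOn_const hfin),
      setAverage_eq, setIntegral_const, volumeReal_halfOpenCube a hℓ, smul_eq_mul, smul_eq_mul]
    field_simp
  calc _ = |∫ y in halfOpenCube a ℓ, (β y - c)| := by
        rw [h1, abs_mul, abs_of_nonneg (pow_nonneg hℓ.le d)]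
    _ ≤ _ := abs_integral_le_integral_abs

/-- The sets selected by the Calderón–Zygmund decomposition fill at most half of the cube. -/
theorem half_le_volumeReal_diff {g : (Fin d → ℝ) → ℝ} (hg0 : ∀ x, 0 ≤ g x)
    (hg : LocallyIntegrable g volume) {a : Fin d → ℝ} {ℓ : ℝ} (hℓ : 0 < ℓ) {B : ℝ} (hB : 0 < B)
    (hgB : ∫ x in halfOpenCube a ℓ, g x ≤ B * ℓ ^ d) {J : Set ((Fin d → ℝ) × ℝ)} (hJ : J.Countable)
    (h : ∀ p ∈ J, 0 < p.2 ∧ halfOpenCube p.1 p.2 ⊆ halfOpenCube a ℓ ∧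
        2 * B * p.2 ^ d < ∫ x in halfOpenCube p.1 p.2, g x)
    (hd : J.PairwiseDisjoint (fun p => halfOpenCube p.1 p.2)) :
    1 / 2 * ℓ ^ d ≤ volume.real (halfOpenCube a ℓ \ ⋃ p ∈ J, halfOpenCube p.1 p.2) := by
  set U := ⋃ p ∈ J, halfOpenCube p.1 p.2
  have hU : MeasurableSet U := MeasurableSet.biUnion hJ fun p _ => measurableSet_halfOpenCube _ _
  have hUQ : U ⊆ halfOpenCube a ℓ := Set.iUnion₂_subset fun p hp => (h p hp).2.1
  have hfin : volume (halfOpenCube a ℓ) ≠ ∞ := by simp [volume_halfOpenCube]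
  have hi := integrableOn_halfOpenCube hg a ℓ
  have key : 2 * B * volume.real U ≤ B * ℓ ^ d := by
    refine le_trans ?_ ((setIntegral_mono_set hi (Filter.Eventually.of_forall hg0)
      (Filter.Eventually.of_forall hUQ)).trans hgB)
    have : Countable J := hJ.to_subtype
    have hUe : U = ⋃ p : J, halfOpenCube p.1.1 p.1.2 := Set.biUnion_eq_iUnion _ _
    have hs := hasSum_integral_iUnion (f := g) (μ := volume)
      (s := fun p : J => halfOpenCube p.1.1 p.1.2) (fun p => measurableSet_halfOpenCube _ _)
      (fun p q hpq => hd p.2 q.2 (fun e => hpq (Subtype.ext e)))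
      (hi.mono_set (hUe ▸ hUQ))
    have hs' := hasSum_integral_iUnion (f := fun _ => 2 * B) (μ := volume)
      (s := fun p : J => halfOpenCube p.1.1 p.1.2) (fun p => measurableSet_halfOpenCube _ _)
      (fun p q hpq => hd p.2 q.2 (fun e => hpq (Subtype.ext e)))
      ((integrableOn_const hfin).mono_set (hUe ▸ hUQ))
    rw [← hUe] at hs hs'
    have := hasSum_le (fun p : J => ?_) hs' hs
    · rw [setIntegral_const, smul_eq_mul, mul_comm] at this
      exact this
    · rw [setIntegral_const, volumeReal_halfOpenCube _ (h p p.2).1, smul_eq_mul, mul_comm]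
      exact (h p p.2).2.2.le
  rw [measureReal_sdiff hUQ hU hfin, volumeReal_halfOpenCube a hℓ]
  have : 2 * volume.real U ≤ ℓ ^ d := by
    by_contra! hlt
    nlinarith
  linarith

/-- One step of the weighted John–Nirenberg iteration. -/
theorem lintegral_exp_osc_step {μ : Measure (Fin d → ℝ)} (hμ : μ ≪ volume) {η : ℝ}
    (hη1 : η ≤ 1) (hμη : HasHalfProportion μ η) {β : (Fin d → ℝ) → ℝ} {B : ℝ} (hB : 0 < B)
    (hβ : HasOscBound β B) {s : ℝ} (hs : 0 ≤ s) {C : ℝ} (hC : 1 ≤ C)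
    (h : ∀ (a : Fin d → ℝ) (ℓ : ℝ), 0 < ℓ →
      ∫⁻ x in halfOpenCube a ℓ,
        ENNReal.ofReal (Real.exp (s * |β x - ⨍ y in halfOpenCube a ℓ, β y|)) ∂μ ≤
          ENNReal.ofReal C * μ (halfOpenCube a ℓ))
    (a : Fin d → ℝ) {ℓ : ℝ} (hℓ : 0 < ℓ) :
    ∫⁻ x in halfOpenCube a ℓ,
        ENNReal.ofReal (Real.exp (s * |β x - ⨍ y in halfOpenCube a ℓ, β y|)) ∂μ ≤
      ENNReal.ofReal (Real.exp (s * (2 ^ (d + 1) * B)) * (η + (1 - η) * C)) *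
        μ (halfOpenCube a ℓ) := by
  set Q := halfOpenCube a ℓ with hQ
  set m := ⨍ y in Q, β y with hm
  -- Stopping at height `2 * B` gives averages at most `2 ^ d * (2 * B)` on selected cubes. This `Λ`
  -- bounds both the oscillation off those cubes and the change of mean when passing to one of them.
  set Λ := 2 ^ (d + 1) * B with hΛ
  have h2d : (1 : ℝ) ≤ 2 ^ d := one_le_pow₀ (by norm_num)
  have hΛ2 : 2 * B ≤ Λ := by rw [hΛ, pow_succ]; nlinarith
  have hQfin : μ Q ≠ ∞ := (hμη a ℓ hℓ).1
  have hg := locallyIntegrable_abs_sub hβ.1 m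
  obtain ⟨J, hJ, hJp, hJd, hJae⟩ := exists_calderonZygmund (c := 2 * B)
    (fun x => abs_nonneg (β x - m)) hg a hℓ
    ((hβ.2 a ℓ hℓ).trans (by nlinarith [pow_pos hℓ d]))
  have hhalf := half_le_volumeReal_diff (fun x => abs_nonneg (β x - m)) hg hℓ hB (hβ.2 a ℓ hℓ) hJ
    (fun p hp => ⟨(hJp p hp).1, (hJp p hp).2.1, (hJp p hp).2.2.1⟩) hJd
  set U := ⋃ p ∈ J, halfOpenCube p.1 p.2
  have hU : MeasurableSet U := MeasurableSet.biUnion hJ fun p _ => measurableSet_halfOpenCube _ _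
  have hUQ : U ⊆ Q := Set.iUnion₂_subset fun p hp => (hJp p hp).2.1
  have hQm : MeasurableSet Q := measurableSet_halfOpenCube _ _
  have hE := (hμη a ℓ hℓ).2 _ Set.sdiff_subset (hQm.diff hU) hhalf
  have h1 : ∫⁻ x in Q \ U, ENNReal.ofReal (Real.exp (s * |β x - m|)) ∂μ ≤
      ENNReal.ofReal (Real.exp (s * Λ)) * μ (Q \ U) := by
    rw [← setLIntegral_const]
    refine setLIntegral_mono_ae measurable_const.aemeasurable ?_
    filter_upwards [hμ.ae_le hJae] with x hx hxE
    gcongr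
    exact (hx hxE.1 hxE.2).trans hΛ2
  have h2 : ∫⁻ x in U, ENNReal.ofReal (Real.exp (s * |β x - m|)) ∂μ ≤
      ENNReal.ofReal (Real.exp (s * Λ)) * (ENNReal.ofReal C * μ U) := by
    rw [lintegral_biUnion hJ (fun p _ => measurableSet_halfOpenCube _ _) hJd,
      measure_biUnion hJ hJd (fun p _ => measurableSet_halfOpenCube _ _),
      ← ENNReal.tsum_mul_left, ← ENNReal.tsum_mul_left]
    refine ENNReal.tsum_le_tsum fun p => ?_
    obtain ⟨hp0, -, -, hp⟩ := hJp p p.2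
    refine le_trans ?_ (mul_le_mul_right (h p.1.1 p.1.2 hp0) _)
    rw [← lintegral_const_mul' _ _ ENNReal.ofReal_ne_top]
    refine lintegral_mono fun x => ?_
    rw [← ENNReal.ofReal_mul (Real.exp_pos _).le, ← Real.exp_add, ← mul_add]
    gcongr
    set mp := ⨍ y in halfOpenCube p.1.1 p.1.2, β y
    have h3 : |mp - m| ≤ Λ := by
      have h4 := (abs_average_sub_le hβ.1 m p.1.1 hp0).trans hp
      have h5 : (0 : ℝ) < p.1.2 ^ d := pow_pos hp0 d
      have := le_of_mul_le_mul_right h4 h5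
      rw [hΛ, pow_succ]; linarith
    calc |β x - m| = |(mp - m) + (β x - mp)| := by congr 1; ring
      _ ≤ _ := (abs_add_le _ _).trans (by gcongr)
  have hsplit : ∫⁻ x in Q, ENNReal.ofReal (Real.exp (s * |β x - m|)) ∂μ =
      ∫⁻ x in U, ENNReal.ofReal (Real.exp (s * |β x - m|)) ∂μ +
      ∫⁻ x in Q \ U, ENNReal.ofReal (Real.exp (s * |β x - m|)) ∂μ := by
    rw [← lintegral_inter_add_sdiff _ Q hU, Set.inter_eq_right.2 hUQ]
  have hUfin : μ U ≠ ∞ := ne_top_of_le_ne_top hQfin (measure_mono hUQ)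
  have hEfin : μ (Q \ U) ≠ ∞ := ne_top_of_le_ne_top hQfin (measure_mono Set.sdiff_subset)
  have hadd : μ.real U + μ.real (Q \ U) = μ.real Q := by
    rw [measureReal_sdiff hUQ hU hQfin]; ring
  rw [hsplit]
  refine (add_le_add h2 h1).trans ?_
  rw [← mul_add, ENNReal.ofReal_mul (Real.exp_pos _).le, mul_assoc]
  gcongr
  rw [← ofReal_measureReal hUfin, ← ofReal_measureReal hEfin, ← ofReal_measureReal hQfin,
    ← ENNReal.ofReal_mul (by linarith), ← ENNReal.ofReal_add (by positivity) (by positivity),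
    ← ENNReal.ofReal_mul (by nlinarith)]
  -- At least the proportion `η` of the mass lies off the selected cubes and is counted with `1`
  -- instead of `C ≥ 1`.
  apply ENNReal.ofReal_le_ofReal
  nlinarith [mul_le_mul_of_nonneg_left hE (sub_nonneg.2 hC)]

/-- Weighted John–Nirenberg inequality for bounded functions. -/
theorem lintegral_exp_osc_le_of_bounded {μ : Measure (Fin d → ℝ)} (hμ : μ ≪ volume) {η : ℝ}
    (hη0 : 0 < η) (hη1 : η ≤ 1) (hμη : HasHalfProportion μ η) {β : (Fin d → ℝ) → ℝ} {B : ℝ}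
    (hB : 0 < B) (hβ : HasOscBound β B) {N : ℝ} (hN : ∀ x, |β x| ≤ N) {s : ℝ} (hs : 0 ≤ s)
    (hsη : Real.exp (s * (2 ^ (d + 1) * B)) ≤ 1 + η / 2) (a : Fin d → ℝ) {ℓ : ℝ} (hℓ : 0 < ℓ) :
    ∫⁻ x in halfOpenCube a ℓ,
        ENNReal.ofReal (Real.exp (s * |β x - ⨍ y in halfOpenCube a ℓ, β y|)) ∂μ ≤
      4 * μ (halfOpenCube a ℓ) := by
  have hN0 : 0 ≤ N := (abs_nonneg _).trans (hN 0)
  -- `S` collects the constants valid for all cubes at once. Boundedness of `β` only serves to make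
  -- it nonempty; the final constant does not depend on `N`.
  let S : Set ℝ := {C | 1 ≤ C ∧ ∀ (a : Fin d → ℝ) (ℓ : ℝ), 0 < ℓ →
      ∫⁻ x in halfOpenCube a ℓ,
        ENNReal.ofReal (Real.exp (s * |β x - ⨍ y in halfOpenCube a ℓ, β y|)) ∂μ ≤
          ENNReal.ofReal C * μ (halfOpenCube a ℓ)}
  have hmem : Real.exp (s * (2 * N)) ∈ S := by
    refine ⟨Real.one_le_exp (by positivity), fun a ℓ hℓ => ?_⟩
    rw [← setLIntegral_const]
    refine lintegral_mono fun x => ?_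
    gcongr
    have h1 := abs_average_sub_le hβ.1 0 a hℓ
    have h2 : ∫ y in halfOpenCube a ℓ, |β y - 0| ≤ N * ℓ ^ d := by
      have := setIntegral_mono_on (μ := volume) (s := halfOpenCube a ℓ)
        (integrableOn_halfOpenCube (locallyIntegrable_abs_sub hβ.1 0) a ℓ)
        (integrableOn_const (C := N) (by simp [volume_halfOpenCube]))
        (measurableSet_halfOpenCube a ℓ) (fun x _ => by simpa using hN x)
      rwa [setIntegral_const, volumeReal_halfOpenCube a hℓ, smul_eq_mul, mul_comm _ N] at this
    have h3 := le_of_mul_le_mul_right (h1.trans h2) (pow_pos hℓ d)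
    rw [sub_zero] at h3
    calc _ ≤ |β x| + |⨍ y in halfOpenCube a ℓ, β y| := abs_sub _ _
      _ ≤ 2 * N := by linarith [hN x]
  have hbdd : BddBelow S := ⟨1, fun C hC => hC.1⟩
  have hstep : ∀ C ∈ S, sInf S ≤ (1 - η / 2) * C + 3 / 2 * η := by
    intro C hC
    have h1 : 1 ≤ η + (1 - η) * C := by nlinarith [hC.1]
    have hnew : Real.exp (s * (2 ^ (d + 1) * B)) * (η + (1 - η) * C) ∈ S :=
      ⟨one_le_mul_of_one_le_of_one_le (Real.one_le_exp (by positivity)) h1,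
        fun a ℓ hℓ => lintegral_exp_osc_step hμ hη1 hμη hB hβ hs hC.1 hC.2 a hℓ⟩
    refine (csInf_le hbdd hnew).trans ((mul_le_mul_of_nonneg_right hsη (by linarith)).trans ?_)
    nlinarith [hC.1, mul_nonneg hη0.le hη0.le, mul_nonneg (mul_nonneg hη0.le hη0.le)
      (by linarith [hC.1] : (0 : ℝ) ≤ C)]
  -- The map `C ↦ (1 - η/2) C + 3η/2` is a contraction with fixed point `3`.
  have h3 : sInf S ≤ 3 := by
    have : (sInf S - 3 / 2 * η) / (1 - η / 2) ≤ sInf S := by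
      refine le_csInf ⟨_, hmem⟩ fun C hC => ?_
      rw [div_le_iff₀ (by linarith)]
      linarith [hstep C hC]
    rw [div_le_iff₀ (by linarith)] at this
    nlinarith
  obtain ⟨C, hC, hC4⟩ := exists_lt_of_csInf_lt ⟨_, hmem⟩ (h3.trans_lt (by norm_num : (3 : ℝ) < 4))
  refine (hC.2 a ℓ hℓ).trans ?_
  gcongr
  exact ENNReal.ofReal_le_of_le_toReal (by simpa using hC4.le)

end

/-! ### Lipschitz images, truncation and the unbounded John–Nirenberg inequality -/

noncomputable section
variable {d : ℕ}

/-- The constant `φ c` competes with the mean of `φ ∘ u`; replacing it by the mean at most doubles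
the oscillation. Allowing arbitrary `c` in a normed space covers truncations, absolute values, and
real and imaginary parts alike. -/
theorem HasOscBound.of_lipschitz {E : Type*} [NormedAddCommGroup E] {u : (Fin d → ℝ) → E}
    (hu : LocallyIntegrable u volume) {B : ℝ}
    (hB : ∀ (a : Fin d → ℝ) (ℓ : ℝ), 0 < ℓ →
      ∃ c : E, ∫ x in halfOpenCube a ℓ, ‖u x - c‖ ≤ B * ℓ ^ d)
    {φ : E → ℝ} (hφ : LipschitzWith 1 φ) :
    HasOscBound (fun x => φ (u x)) (2 * B) := by
  have hlip : ∀ x y, |φ x - φ y| ≤ ‖x - y‖ := fun x y => by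
    have := hφ.dist_le_mul x y
    rwa [NNReal.coe_one, one_mul, Real.dist_eq, dist_eq_norm] at this
  have hloc : LocallyIntegrable (fun x => φ (u x)) volume := by
    intro x
    obtain ⟨s, hs, hi⟩ := hu x
    obtain ⟨t, ht, hit⟩ := locallyIntegrable_const (μ := (volume : Measure (Fin d → ℝ))) |φ 0| x
    refine ⟨s ∩ t, Filter.inter_mem hs ht, ?_⟩
    have h1 := (hi.mono_set (Set.inter_subset_left (t := t))).norm.add
      (hit.mono_set (Set.inter_subset_right (s := s)))
    refine h1.mono' (hφ.continuous.comp_aestronglyMeasurable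
      (hi.mono_set (Set.inter_subset_left (t := t))).aestronglyMeasurable) ?_
    refine Filter.Eventually.of_forall fun y => ?_
    have := hlip (u y) 0
    rw [sub_zero] at this
    have h2 := abs_sub_abs_le_abs_sub (φ (u y)) (φ 0)
    simp only [Pi.add_apply, Real.norm_eq_abs]
    linarith
  refine ⟨hloc, fun a ℓ hℓ => ?_⟩
  obtain ⟨c, hc⟩ := hB a ℓ hℓ
  have hfin : volume (halfOpenCube a ℓ) ≠ ∞ := by simp [volume_halfOpenCube]
  set m := ⨍ y in halfOpenCube a ℓ, φ (u y)
  have h1 : ∫ x in halfOpenCube a ℓ, |φ (u x) - φ c| ≤ B * ℓ ^ d := by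
    refine le_trans ?_ hc
    refine integral_mono (integrableOn_halfOpenCube (locallyIntegrable_abs_sub hloc _) a ℓ)
      ((integrableOn_halfOpenCube hu a ℓ).sub (integrableOn_const hfin)).norm fun x => ?_
    exact hlip _ _
  have h2 := abs_average_sub_le hloc (φ c) a hℓ
  calc ∫ x in halfOpenCube a ℓ, |φ (u x) - m|
      ≤ ∫ x in halfOpenCube a ℓ, (|φ (u x) - φ c| + |m - φ c|) := by
        refine integral_mono (integrableOn_halfOpenCube (locallyIntegrable_abs_sub hloc _) a ℓ)
          ((integrableOn_halfOpenCube (locallyIntegrable_abs_sub hloc _) a ℓ).add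
            (integrableOn_const hfin)) fun x => ?_
        exact (abs_sub_le _ (φ c) _).trans (by rw [abs_sub_comm (φ c)])
    _ = (∫ x in halfOpenCube a ℓ, |φ (u x) - φ c|) + |m - φ c| * ℓ ^ d := by
        rw [integral_add (integrableOn_halfOpenCube (locallyIntegrable_abs_sub hloc _) a ℓ)
          (integrableOn_const hfin), setIntegral_const, volumeReal_halfOpenCube a hℓ, smul_eq_mul,
          mul_comm (ℓ ^ d)]
    _ ≤ 2 * B * ℓ ^ d := by linarith

/-- Truncation of real numbers to `[-N, N]`. -/
def clamp (N t : ℝ) : ℝ := max (-N) (min t N)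

theorem lipschitzWith_clamp (N : ℝ) : LipschitzWith 1 (clamp N) :=
  (LipschitzWith.id.min_const N).const_max (-N)

theorem abs_clamp_le {N : ℝ} (hN : 0 ≤ N) (t : ℝ) : |clamp N t| ≤ N :=
  abs_le.2 ⟨le_max_left _ _, max_le (by linarith) (min_le_right _ _)⟩

theorem clamp_eq_self {N t : ℝ} (h : |t| ≤ N) : clamp N t = t := by
  rw [abs_le] at h
  rw [clamp, min_eq_left h.2, max_eq_right h.1]

theorem abs_clamp_le_abs {N : ℝ} (hN : 0 ≤ N) (t : ℝ) : |clamp N t| ≤ |t| := by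
  have := (lipschitzWith_clamp N).dist_le_mul t 0
  rwa [NNReal.coe_one, one_mul, Real.dist_eq, Real.dist_eq,
    clamp_eq_self (t := 0) (by simpa using hN), sub_zero, sub_zero] at this

theorem tendsto_clamp (t : ℝ) : Filter.Tendsto (fun n : ℕ => clamp n t) Filter.atTop (nhds t) := by
  obtain ⟨n, hn⟩ := exists_nat_ge |t|
  refine tendsto_const_nhds.congr' ?_
  filter_upwards [Filter.eventually_ge_atTop n] with m hm
  exact (clamp_eq_self (hn.trans (by exact_mod_cast hm))).symm

/-- Weighted John–Nirenberg inequality. -/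
theorem lintegral_exp_osc_le {μ : Measure (Fin d → ℝ)} (hμ : μ ≪ volume) {η : ℝ}
    (hη0 : 0 < η) (hη1 : η ≤ 1) (hμη : HasHalfProportion μ η) {β : (Fin d → ℝ) → ℝ} {B : ℝ}
    (hB : 0 < B) (hβ : HasOscBound β B) {s : ℝ} (hs : 0 ≤ s)
    (hsη : s * (2 ^ (d + 2) * B) ≤ η / 4) (a : Fin d → ℝ) {ℓ : ℝ} (hℓ : 0 < ℓ) :
    ∫⁻ x in halfOpenCube a ℓ,
        ENNReal.ofReal (Real.exp (s * |β x - ⨍ y in halfOpenCube a ℓ, β y|)) ∂μ ≤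
      4 * μ (halfOpenCube a ℓ) := by
  have hosc : ∀ n : ℕ, HasOscBound (fun x => clamp n (β x)) (2 * B) := fun n =>
    HasOscBound.of_lipschitz hβ.1 (fun a ℓ hℓ => ⟨_, hβ.2 a ℓ hℓ⟩) (lipschitzWith_clamp n)
  -- Truncation doubles the oscillation bound, whence `2 ^ (d + 2)` in the hypothesis. With `t ≤
  -- η/4`, `e^t ≤ 1/(1 - t) ≤ 1 + η/2`.
  have hexp : Real.exp (s * (2 ^ (d + 1) * (2 * B))) ≤ 1 + η / 2 := by
    rw [show s * (2 ^ (d + 1) * (2 * B)) = s * (2 ^ (d + 2) * B) by ring]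
    set t := s * (2 ^ (d + 2) * B) with ht
    have ht0 : 0 ≤ t := by positivity
    refine (Real.exp_bound_div_one_sub_of_interval ht0 (by linarith)).trans ?_
    rw [div_le_iff₀ (by linarith)]
    nlinarith
  have hbd := fun n : ℕ => lintegral_exp_osc_le_of_bounded hμ hη0 hη1 hμη (by positivity)
    (hosc n) (fun x => abs_clamp_le n.cast_nonneg (β x)) hs hexp a hℓ
  have havg : Filter.Tendsto (fun n : ℕ => ⨍ y in halfOpenCube a ℓ, clamp n (β y)) Filter.atTop
      (nhds (⨍ y in halfOpenCube a ℓ, β y)) := by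
    simp only [setAverage_eq]
    refine Filter.Tendsto.const_smul ?_ _
    refine tendsto_integral_of_dominated_convergence (fun y => |β y|)
      (fun n => ((integrableOn_halfOpenCube (hosc n).1 a ℓ).aestronglyMeasurable))
      (integrableOn_halfOpenCube hβ.1 a ℓ).norm
      (fun n => Filter.Eventually.of_forall fun x => abs_clamp_le_abs n.cast_nonneg _)
      (Filter.Eventually.of_forall fun x => tendsto_clamp _)
  have hlim : ∀ x, Filter.Tendsto (fun n : ℕ => ENNReal.ofReal (Real.exp
      (s * |clamp n (β x) - ⨍ y in halfOpenCube a ℓ, clamp n (β y)|))) Filter.atTop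
      (nhds (ENNReal.ofReal (Real.exp (s * |β x - ⨍ y in halfOpenCube a ℓ, β y|)))) := by
    intro x
    refine ENNReal.tendsto_ofReal ((Real.continuous_exp.tendsto _).comp ?_)
    exact ((tendsto_clamp _).sub havg).abs.const_mul s
  calc _ = ∫⁻ x in halfOpenCube a ℓ, Filter.liminf (fun n : ℕ => ENNReal.ofReal (Real.exp
      (s * |clamp n (β x) - ⨍ y in halfOpenCube a ℓ, clamp n (β y)|))) Filter.atTop ∂μ :=
        lintegral_congr fun x => (hlim x).liminf_eq.symm
    _ ≤ _ := lintegral_liminf_le' fun n => ?_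
    _ ≤ _ := (Filter.liminf_le_liminf (Filter.Eventually.of_forall hbd)).trans
        (Filter.liminf_const _).le
  have : AEMeasurable (fun x => clamp n (β x)) (μ.restrict (halfOpenCube a ℓ)) :=
    ((hosc n).1.aestronglyMeasurable.aemeasurable.mono_ac hμ).restrict
  fun_prop

end

/-! ### Muckenhoupt weights and the mass of half cubes -/

noncomputable section
variable {d : ℕ}

theorem volume_halfOpenCube_ne_zero (a : Fin d → ℝ) {ℓ : ℝ} (hℓ : 0 < ℓ) :
    volume (halfOpenCube a ℓ) ≠ 0 := by
  simp [volume_halfOpenCube, hℓ]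

theorem volume_halfOpenCube_ne_top (a : Fin d → ℝ) (ℓ : ℝ) :
    volume (halfOpenCube a ℓ) ≠ ∞ := by
  simp [volume_halfOpenCube]

theorem muckenhouptChar_le_iff {r : ℝ} (hr : 1 < r) {w : (Fin d → ℝ) → ℝ} {A : ℝ≥0∞} :
    muckenhouptChar r w ≤ A ↔ ∀ (a : Fin d → ℝ) (ℓ : ℝ), 0 < ℓ →
      (∫⁻ x in halfOpenCube a ℓ, ENNReal.ofReal (w x)) *
        (∫⁻ x in halfOpenCube a ℓ, ENNReal.ofReal (w x ^ (-1 / (r - 1)))) ^ (r - 1) ≤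
        A * volume (halfOpenCube a ℓ) ^ r := by
  simp only [muckenhouptChar, iSup_le_iff]
  refine forall₃_congr fun a ℓ hℓ => ?_
  rw [setLAverage_eq, setLAverage_eq, ← measure_congr (halfOpenCube_ae_eq a ℓ),
    ← setLIntegral_congr (halfOpenCube_ae_eq a ℓ), ← setLIntegral_congr (halfOpenCube_ae_eq a ℓ)]
  have h0 := volume_halfOpenCube_ne_zero a hℓ
  have ht := volume_halfOpenCube_ne_top a ℓ
  set v := volume (halfOpenCube a ℓ)
  have hv : v ^ r = v * v ^ (r - 1) := by
    conv_rhs => rw [← ENNReal.rpow_one v, ← ENNReal.rpow_mul, one_mul, ← ENNReal.rpow_add _ _ h0 ht]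
    congr 1; ring
  rw [ENNReal.div_rpow_of_nonneg _ _ (by linarith), ← ENNReal.div_le_iff
    (by simp [h0, ht]) (by simp [h0, ht]), hv]
  rw [ENNReal.mul_div_mul_comm (Or.inr (by simp [h0, ht])) (Or.inl ht)]

theorem aemeasurable_of_isWeight {w : (Fin d → ℝ) → ℝ} (hw : IsWeight w) : AEMeasurable w volume :=
  hw.1.aestronglyMeasurable.aemeasurable

/-- Hölder's inequality for `1 = w^{1/r} w^{-1/r}`. It gives `[w] ≥ 1`, and on subsets of a cube it
is the converse of the `A_r` condition. -/
theorem volume_rpow_le {r : ℝ} (hr : 1 < r) {w : (Fin d → ℝ) → ℝ} (hw : IsWeight w)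
    (E : Set (Fin d → ℝ)) :
    volume E ^ r ≤ (∫⁻ x in E, ENNReal.ofReal (w x)) *
      (∫⁻ x in E, ENNReal.ofReal (w x ^ (-1 / (r - 1)))) ^ (r - 1) := by
  have hr0 : 0 < r := by linarith
  have hr1 : 0 < r - 1 := by linarith
  have hwm := aemeasurable_of_isWeight hw
  have h := ENNReal.lintegral_mul_le_Lp_mul_Lq (volume.restrict E)
    (Real.HolderConjugate.conjExponent hr)
    (f := fun x => ENNReal.ofReal (w x) ^ (1 / r))
    (g := fun x => ENNReal.ofReal (w x ^ (-1 / (r - 1))) ^ ((r - 1) / r))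
    (by fun_prop) (by fun_prop)
  have h1 : ∫⁻ x in E, ((fun x => ENNReal.ofReal (w x) ^ (1 / r)) *
      fun x => ENNReal.ofReal (w x ^ (-1 / (r - 1))) ^ ((r - 1) / r)) x = volume E := by
    rw [← setLIntegral_one]
    refine lintegral_congr_ae (ae_restrict_of_ae ?_)
    filter_upwards [hw.2] with x hx
    rw [Pi.mul_apply, ENNReal.ofReal_rpow_of_pos hx, ENNReal.ofReal_rpow_of_pos (by positivity),
      ← Real.rpow_mul hx.le, ← ENNReal.ofReal_mul (by positivity), ← Real.rpow_add hx,
      show 1 / r + -1 / (r - 1) * ((r - 1) / r) = 0 by field_simp; ring]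
    simp
  rw [h1] at h
  have hq : 1 / Real.conjExponent r = (r - 1) / r := by simp [Real.conjExponent]
  simp only [← ENNReal.rpow_mul, hq] at h
  rw [show (r - 1) / r * Real.conjExponent r = 1 by simp only [Real.conjExponent]; field_simp,
    one_div_mul_cancel hr0.ne'] at h
  simp only [ENNReal.rpow_one] at h
  refine (ENNReal.rpow_le_rpow h hr0.le).trans (le_of_eq ?_)
  rw [ENNReal.mul_rpow_of_nonneg _ _ hr0.le, ← ENNReal.rpow_mul, ← ENNReal.rpow_mul,
    one_div_mul_cancel hr0.ne', ENNReal.rpow_one, div_mul_cancel₀ _ hr0.ne']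

/-- The measure `w dx`. -/
abbrev weightMeasure (w : (Fin d → ℝ) → ℝ) : Measure (Fin d → ℝ) :=
  volume.withDensity fun x => ENNReal.ofReal (w x)

theorem weightMeasure_absolutelyContinuous (w : (Fin d → ℝ) → ℝ) : weightMeasure w ≪ volume :=
  withDensity_absolutelyContinuous _ _

section Muckenhoupt

variable {r : ℝ} {w : (Fin d → ℝ) → ℝ}

theorem one_le_muckenhouptChar (hr : 1 < r) (hw : IsWeight w) : 1 ≤ muckenhouptChar r w := by
  have h := (volume_rpow_le hr hw (halfOpenCube 0 1)).trans
    ((muckenhouptChar_le_iff hr).1 le_rfl 0 1 one_pos)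
  simpa [volume_halfOpenCube] using h

theorem setLIntegral_weight_ne_top (hw : IsWeight w) (a : Fin d → ℝ) (ℓ : ℝ) :
    ∫⁻ x in halfOpenCube a ℓ, ENNReal.ofReal (w x) ≠ ∞ :=
  (integrableOn_halfOpenCube hw.1 a ℓ).lintegral_lt_top.ne

theorem setLIntegral_ofReal_ne_zero {u : (Fin d → ℝ) → ℝ} (hu : AEMeasurable u volume)
    (hu0 : ∀ᵐ x, 0 < u x) (a : Fin d → ℝ) {ℓ : ℝ} (hℓ : 0 < ℓ) :
    ∫⁻ x in halfOpenCube a ℓ, ENNReal.ofReal (u x) ≠ 0 := by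
  rw [Ne, lintegral_eq_zero_iff' hu.ennreal_ofReal.restrict]
  intro h
  have : ∀ᵐ x ∂(volume.restrict (halfOpenCube a ℓ)), False := by
    filter_upwards [h, ae_restrict_of_ae hu0] with x h1 h2
    simp at h1
    linarith
  rw [Filter.eventually_false_iff_eq_bot, ae_eq_bot, Measure.restrict_eq_zero] at this
  exact volume_halfOpenCube_ne_zero a hℓ this

theorem ae_dual_pos (hw : IsWeight w) : ∀ᵐ x, 0 < w x ^ (-1 / (r - 1)) := by
  filter_upwards [hw.2] with x hx
  positivity

theorem aemeasurable_dual (hw : IsWeight w) :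
    AEMeasurable (fun x => w x ^ (-1 / (r - 1))) volume :=
  (aemeasurable_of_isWeight hw).pow_const _

theorem setLIntegral_dual_ne_top (hr : 1 < r) (hw : IsMuckenhoupt r w) (a : Fin d → ℝ) {ℓ : ℝ}
    (hℓ : 0 < ℓ) : ∫⁻ x in halfOpenCube a ℓ, ENNReal.ofReal (w x ^ (-1 / (r - 1))) ≠ ∞ := by
  intro h
  have h1 := (muckenhouptChar_le_iff (w := w) hr).1 le_rfl a ℓ hℓ
  rw [h, ENNReal.top_rpow_of_pos (by linarith), ENNReal.mul_top
    (setLIntegral_ofReal_ne_zero (aemeasurable_of_isWeight hw.1) hw.1.2 a hℓ), top_le_iff] at h1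
  exact ENNReal.mul_ne_top hw.2.ne (ENNReal.rpow_ne_top_of_nonneg (by linarith)
    (volume_halfOpenCube_ne_top a ℓ)) h1

theorem volume_rpow_le_of_half (hr : 1 < r) {a : Fin d → ℝ} {ℓ : ℝ} (hℓ : 0 < ℓ)
    {E : Set (Fin d → ℝ)} (hE : E ⊆ halfOpenCube a ℓ) (h : 1 / 2 * ℓ ^ d ≤ volume.real E) :
    volume (halfOpenCube a ℓ) ^ r ≤ 2 ^ r * volume E ^ r := by
  rw [← ENNReal.mul_rpow_of_nonneg _ _ (by linarith)]
  refine ENNReal.rpow_le_rpow ?_ (by linarith)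
  have hEt : volume E ≠ ∞ := ne_top_of_le_ne_top (volume_halfOpenCube_ne_top a ℓ) (measure_mono hE)
  rw [← ofReal_measureReal hEt, ← ofReal_measureReal (volume_halfOpenCube_ne_top a ℓ),
    volumeReal_halfOpenCube a hℓ, ← ENNReal.ofReal_ofNat 2, ← ENNReal.ofReal_mul (by norm_num)]
  exact ENNReal.ofReal_le_ofReal (by linarith)

theorem hasHalfProportion_of_le {u : (Fin d → ℝ) → ℝ} {D : ℝ} (hD : 0 < D)
    (hfin : ∀ (a : Fin d → ℝ) (ℓ : ℝ), 0 < ℓ →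
      ∫⁻ x in halfOpenCube a ℓ, ENNReal.ofReal (u x) ≠ ∞)
    (h : ∀ (a : Fin d → ℝ) (ℓ : ℝ), 0 < ℓ → ∀ E ⊆ halfOpenCube a ℓ,
      1 / 2 * ℓ ^ d ≤ volume.real E →
      ∫⁻ x in halfOpenCube a ℓ, ENNReal.ofReal (u x) ≤
        ENNReal.ofReal D * ∫⁻ x in E, ENNReal.ofReal (u x)) :
    HasHalfProportion (weightMeasure u) D⁻¹ := by
  intro a ℓ hℓ
  have hQ : weightMeasure u (halfOpenCube a ℓ) = _ :=
    withDensity_apply _ (measurableSet_halfOpenCube a ℓ)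
  refine ⟨hQ ▸ hfin a ℓ hℓ, fun E hE hEm hhalf => ?_⟩
  have h1 := h a ℓ hℓ E hE hhalf
  rw [← hQ, ← withDensity_apply _ hEm] at h1
  have hEt : weightMeasure u E ≠ ∞ :=
    ne_top_of_le_ne_top (hQ ▸ hfin a ℓ hℓ) (measure_mono hE)
  have h2 := ENNReal.toReal_mono (ENNReal.mul_ne_top ENNReal.ofReal_ne_top hEt) h1
  rw [ENNReal.toReal_mul, ENNReal.toReal_ofReal hD.le] at h2
  rw [inv_mul_le_iff₀ hD]
  exact h2

/-- The exponent `max {1, 1 / (r - 1)}`. -/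
abbrev transferExponent (r : ℝ) : ℝ := max 1 (1 / (r - 1))

theorem one_le_toReal_muckenhouptChar (hr : 1 < r) (hw : IsMuckenhoupt r w) :
    1 ≤ (muckenhouptChar r w).toReal := by
  simpa using ENNReal.toReal_mono hw.2.ne (one_le_muckenhouptChar hr hw.1)

theorem one_le_proportion (hr : 1 < r) (hw : IsMuckenhoupt r w) :
    1 ≤ 2 ^ r * (muckenhouptChar r w).toReal :=
  one_le_mul_of_one_le_of_one_le (Real.one_le_rpow (by norm_num) (by linarith))
    (one_le_toReal_muckenhouptChar hr hw)

theorem ofReal_proportion (hw : IsMuckenhoupt r w) :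
    ENNReal.ofReal (2 ^ r * (muckenhouptChar r w).toReal) = 2 ^ r * muckenhouptChar r w := by
  rw [ENNReal.ofReal_mul (by positivity), ENNReal.ofReal_toReal hw.2.ne,
    ← ENNReal.ofReal_rpow_of_pos (by norm_num), ENNReal.ofReal_ofNat]

/-- Compare `A_r` on the cube with Hölder on `E`: bounding the dual mass of `E` by that of the cube
and cancelling it leaves `w(Q) ≤ 2^r [w] w(E)`. The exponent `1` is raised to the maximum so that
one `η` serves both measures. -/
theorem hasHalfProportion_weight (hr : 1 < r) (hw : IsMuckenhoupt r w) :
    HasHalfProportion (weightMeasure w)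
      ((2 ^ r * (muckenhouptChar r w).toReal) ^ transferExponent r)⁻¹ := by
  have hD := one_le_proportion hr hw
  refine hasHalfProportion_of_le (by positivity)
    (fun a ℓ _ => setLIntegral_weight_ne_top hw.1 a ℓ) fun a ℓ hℓ E hE hh => ?_
  have hS0 := setLIntegral_ofReal_ne_zero (aemeasurable_dual (r := r) hw.1) (ae_dual_pos hw.1) a hℓ
  have hSt := setLIntegral_dual_ne_top hr hw a hℓ
  have h1 := (muckenhouptChar_le_iff (w := w) hr).1 le_rfl a ℓ hℓ
  have h2 := volume_rpow_le_of_half hr hℓ hE hh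
  have h3 := volume_rpow_le hr hw.1 E
  have h4 : ∫⁻ x in E, ENNReal.ofReal (w x ^ (-1 / (r - 1))) ≤
    ∫⁻ x in halfOpenCube a ℓ, ENNReal.ofReal (w x ^ (-1 / (r - 1))) := lintegral_mono_set hE
  set S := ∫⁻ x in halfOpenCube a ℓ, ENNReal.ofReal (w x ^ (-1 / (r - 1)))
  have hc0 : S ^ (r - 1) ≠ 0 := by simp [hS0, hSt]
  have hct : S ^ (r - 1) ≠ ∞ := by simp [hS0, hSt]
  have hr1 : 0 ≤ r - 1 := by linarith
  refine (ENNReal.mul_le_mul_iff_left hc0 hct).1 (h1.trans ?_)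
  calc _ ≤ muckenhouptChar r w * (2 ^ r * ((∫⁻ x in E, ENNReal.ofReal (w x)) * S ^ (r - 1))) := by
        gcongr
        exact h2.trans (by gcongr; exact h3.trans (by gcongr))
    _ = ENNReal.ofReal (2 ^ r * (muckenhouptChar r w).toReal) *
        (∫⁻ x in E, ENNReal.ofReal (w x)) * S ^ (r - 1) := by rw [ofReal_proportion hw]; ring
    _ ≤ _ := by
        gcongr
        exact Real.self_le_rpow_of_one_le hD (le_max_left _ _)

/-- Here the mass of `w` cancels instead, and the dual masses are compared through their powers `r -
1`; taking the root produces the exponent `1 / (r - 1)`. -/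
theorem hasHalfProportion_dual (hr : 1 < r) (hw : IsMuckenhoupt r w) :
    HasHalfProportion (weightMeasure fun x => w x ^ (-1 / (r - 1)))
      ((2 ^ r * (muckenhouptChar r w).toReal) ^ transferExponent r)⁻¹ := by
  have hD := one_le_proportion hr hw
  have hr1 : 0 < r - 1 := by linarith
  refine hasHalfProportion_of_le (by positivity)
    (fun a ℓ hℓ => setLIntegral_dual_ne_top hr hw a hℓ) fun a ℓ hℓ E hE hh => ?_
  have hW0 := setLIntegral_ofReal_ne_zero (aemeasurable_of_isWeight hw.1) hw.1.2 a hℓ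
  have hWt := setLIntegral_weight_ne_top hw.1 a ℓ
  have h1 := (muckenhouptChar_le_iff (w := w) hr).1 le_rfl a ℓ hℓ
  have h2 := volume_rpow_le_of_half hr hℓ hE hh
  have h3 := volume_rpow_le hr hw.1 E
  have h4 : ∫⁻ x in E, ENNReal.ofReal (w x) ≤
    ∫⁻ x in halfOpenCube a ℓ, ENNReal.ofReal (w x) := lintegral_mono_set hE
  set W := ∫⁻ x in halfOpenCube a ℓ, ENNReal.ofReal (w x)
  set S := ∫⁻ x in halfOpenCube a ℓ, ENNReal.ofReal (w x ^ (-1 / (r - 1)))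
  set T := ∫⁻ x in E, ENNReal.ofReal (w x ^ (-1 / (r - 1)))
  set D := 2 ^ r * (muckenhouptChar r w).toReal
  have h5 : S ^ (r - 1) ≤ ENNReal.ofReal D * T ^ (r - 1) := by
    refine (ENNReal.mul_le_mul_iff_right hW0 hWt).1 (h1.trans ?_)
    calc _ ≤ muckenhouptChar r w * (2 ^ r * (W * T ^ (r - 1))) := by
          gcongr
          exact h2.trans (by gcongr; exact h3.trans (by gcongr))
      _ = W * (ENNReal.ofReal D * T ^ (r - 1)) := by rw [ofReal_proportion hw]; ring
  have h6 := ENNReal.rpow_le_rpow h5 (by positivity : 0 ≤ 1 / (r - 1))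
  rw [ENNReal.mul_rpow_of_nonneg _ _ (by positivity), ← ENNReal.rpow_mul, ← ENNReal.rpow_mul,
    mul_one_div_cancel hr1.ne', ENNReal.rpow_one, ENNReal.rpow_one,
    ENNReal.ofReal_rpow_of_nonneg (by positivity) (by positivity)] at h6
  refine h6.trans ?_
  gcongr
  exact le_max_right _ _

end Muckenhoupt

end

/-! ### Exponential perturbation of weights -/

noncomputable section
variable {d : ℕ}

/-- With `m` the mean of `β`, `e^{sβ} ≤ e^{sm} e^{|s||β - m|}`, and John–Nirenberg bounds the last
factor on average. -/
theorem setLIntegral_exp_mul_le {u : (Fin d → ℝ) → ℝ} (hu : AEMeasurable u volume) {η : ℝ}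
    (hη0 : 0 < η) (hη1 : η ≤ 1) (huη : HasHalfProportion (weightMeasure u) η)
    {β : (Fin d → ℝ) → ℝ} {B : ℝ} (hB : 0 < B) (hβ : HasOscBound β B) {s : ℝ}
    (hs : |s| * (2 ^ (d + 2) * B) ≤ η / 4) (a : Fin d → ℝ) {ℓ : ℝ} (hℓ : 0 < ℓ) :
    ∫⁻ x in halfOpenCube a ℓ, ENNReal.ofReal (Real.exp (s * β x) * u x) ≤
      ENNReal.ofReal (Real.exp (s * ⨍ y in halfOpenCube a ℓ, β y)) *
        (4 * ∫⁻ x in halfOpenCube a ℓ, ENNReal.ofReal (u x)) := by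
  have h := lintegral_exp_osc_le (weightMeasure_absolutelyContinuous u) hη0 hη1 huη hB hβ
    (abs_nonneg s) hs a hℓ
  have hβm := hβ.1.aestronglyMeasurable.aemeasurable
  rw [withDensity_apply _ (measurableSet_halfOpenCube a ℓ)] at h
  refine le_trans ?_ (mul_le_mul_right h _)
  rw [restrict_withDensity (measurableSet_halfOpenCube a ℓ),
    lintegral_withDensity_eq_lintegral_mul₀ hu.ennreal_ofReal.restrict (by
      have := hβm.restrict (s := halfOpenCube a ℓ); fun_prop),
    ← lintegral_const_mul' _ _ ENNReal.ofReal_ne_top]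
  refine lintegral_mono fun x => ?_
  rw [Pi.mul_apply, mul_comm (ENNReal.ofReal (u x)), ← mul_assoc,
    ← ENNReal.ofReal_mul (Real.exp_pos _).le, ← Real.exp_add,
    ENNReal.ofReal_mul (Real.exp_pos _).le]
  gcongr
  rw [← abs_mul, mul_sub]
  linarith [le_abs_self (s * β x - s * ⨍ y in halfOpenCube a ℓ, β y)]

theorem isWeight_of_setLIntegral_ne_top {u : (Fin d → ℝ) → ℝ} (hu : AEMeasurable u volume)
    (hu0 : ∀ᵐ x, 0 < u x)
    (h : ∀ (a : Fin d → ℝ) (ℓ : ℝ), 0 < ℓ →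
      ∫⁻ x in halfOpenCube a ℓ, ENNReal.ofReal (u x) ≠ ∞) : IsWeight u := by
  refine ⟨fun x => ⟨axisCube (fun i => x i - 1) 2, ?_, ?_⟩, hu0⟩
  · rw [axisCube_eq_closedBall _ two_pos]
    convert Metric.closedBall_mem_nhds x one_pos using 2
    · funext i; ring
    · norm_num
  · rw [IntegrableOn, ← Measure.restrict_congr_set (halfOpenCube_ae_eq _ _)]
    refine ⟨hu.aestronglyMeasurable.restrict, ?_⟩
    rw [hasFiniteIntegral_iff_ofReal (ae_restrict_of_ae (hu0.mono fun x hx => hx.le))]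
    exact (h _ _ two_pos).lt_top

/-- The width of perturbation allowed for weights, up to the dependence on the characteristic. -/
def perturbationConstant (d : ℕ) (r : ℝ) : ℝ :=
  ((2 ^ r) ^ transferExponent r)⁻¹ / (2 ^ (d + 4) * transferExponent r)

theorem transferExponent_pos (r : ℝ) : 0 < transferExponent r :=
  one_pos.trans_le (le_max_left _ _)

theorem perturbationConstant_pos (d : ℕ) (r : ℝ) : 0 < perturbationConstant d r := by
  have := transferExponent_pos r
  unfold perturbationConstant
  positivity

section

variable {r : ℝ} {w β : (Fin d → ℝ) → ℝ} {B s : ℝ}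

theorem exp_mul_dual (hw : ∀ᵐ x, 0 < w x) (s : ℝ) :
    ∀ᵐ x, (Real.exp (s * β x) * w x) ^ (-1 / (r - 1)) =
      Real.exp (s * (-1 / (r - 1)) * β x) * w x ^ (-1 / (r - 1)) := by
  filter_upwards [hw] with x hx
  rw [Real.mul_rpow (Real.exp_pos _).le hx.le, ← Real.exp_mul]
  congr 2; ring

/-- Small exponential perturbations by functions of bounded mean oscillation preserve the
Muckenhoupt class. -/
theorem IsMuckenhoupt.exp_mul (hr : 1 < r) (hw : IsMuckenhoupt r w) (hB : 0 < B)
    (hβ : HasOscBound β B) (hs : |s| * B ≤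
      perturbationConstant d r * (muckenhouptChar r w).toReal ^ (-transferExponent r)) :
    IsMuckenhoupt r (fun x => Real.exp (s * β x) * w x) ∧
      muckenhouptChar r (fun x => Real.exp (s * β x) * w x) ≤ 4 ^ r * muckenhouptChar r w := by
  have hr1 : 0 < r - 1 := by linarith
  have hD := one_le_proportion hr hw
  have hA := one_le_toReal_muckenhouptChar hr hw
  have hm := transferExponent_pos r
  set η := ((2 ^ r * (muckenhouptChar r w).toReal) ^ transferExponent r)⁻¹ with hη
  have hη0 : 0 < η := by positivity
  have hη1 : η ≤ 1 := inv_le_one_of_one_le₀ (Real.one_le_rpow hD hm.le)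
  -- The dual weight is perturbed with exponent `-s / (r - 1)`, so the factor `transferExponent r`
  -- covers both cases. The `2 ^ (d + 4)` in `perturbationConstant` is `4 * 2 ^ (d + 2)`.
  have hsm : |s| * transferExponent r * (2 ^ (d + 2) * B) ≤ η / 4 := by
    calc |s| * transferExponent r * (2 ^ (d + 2) * B)
        = transferExponent r * 2 ^ (d + 2) * (|s| * B) := by ring
      _ ≤ transferExponent r * 2 ^ (d + 2) * (perturbationConstant d r *
          (muckenhouptChar r w).toReal ^ (-transferExponent r)) := by gcongr
      _ = η / 4 := by
        rw [hη, perturbationConstant, Real.mul_rpow (by positivity) (by positivity),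
          Real.rpow_neg (by positivity), pow_add, pow_add]
        field_simp
        norm_num
  have hs1 : |s| * (2 ^ (d + 2) * B) ≤ η / 4 :=
    le_trans (by gcongr; exact le_mul_of_one_le_right (abs_nonneg _) (le_max_left _ _)) hsm
  have hs2 : |s * (-1 / (r - 1))| * (2 ^ (d + 2) * B) ≤ η / 4 := by
    refine le_trans ?_ hsm
    rw [abs_mul, show |-1 / (r - 1)| = 1 / (r - 1) by
      rw [abs_div, abs_neg, abs_one, abs_of_pos hr1]]
    gcongr
    exact le_max_right _ _
  have hwm := aemeasurable_of_isWeight hw.1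
  have hβm := hβ.1.aestronglyMeasurable.aemeasurable
  have h1 := fun (a : Fin d → ℝ) (ℓ : ℝ) (hℓ : 0 < ℓ) => setLIntegral_exp_mul_le hwm hη0 hη1
    (hasHalfProportion_weight hr hw) hB hβ hs1 a hℓ
  have h2 := fun (a : Fin d → ℝ) (ℓ : ℝ) (hℓ : 0 < ℓ) => setLIntegral_exp_mul_le
    (aemeasurable_dual hw.1) hη0 hη1 (hasHalfProportion_dual hr hw) hB hβ hs2 a hℓ
  have hle : muckenhouptChar r (fun x => Real.exp (s * β x) * w x) ≤
      4 ^ r * muckenhouptChar r w := by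
    rw [muckenhouptChar_le_iff hr]
    intro a ℓ hℓ
    rw [lintegral_congr_ae (f := fun x => ENNReal.ofReal
        ((Real.exp (s * β x) * w x) ^ (-1 / (r - 1))))
      (g := fun x => ENNReal.ofReal
        (Real.exp (s * (-1 / (r - 1)) * β x) * w x ^ (-1 / (r - 1))))
      (ae_restrict_of_ae ((exp_mul_dual hw.1.2 s).mono fun x hx => congrArg ENNReal.ofReal hx))]
    refine (mul_le_mul' (h1 a ℓ hℓ) (ENNReal.rpow_le_rpow (h2 a ℓ hℓ) hr1.le)).trans ?_
    rw [ENNReal.mul_rpow_of_nonneg _ _ hr1.le, ENNReal.mul_rpow_of_nonneg _ _ hr1.le,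
      ENNReal.ofReal_rpow_of_pos (Real.exp_pos _), ← Real.exp_mul]
    set m := ⨍ y in halfOpenCube a ℓ, β y
    -- The exponentials of the mean are inverse to each other, so the mean of `β` leaves no trace in
    -- the characteristic.
    rw [show s * (-1 / (r - 1)) * m * (r - 1) = -(s * m) by field_simp]
    have h3 := (muckenhouptChar_le_iff (w := w) hr).1 le_rfl a ℓ hℓ
    set W := ∫⁻ x in halfOpenCube a ℓ, ENNReal.ofReal (w x)
    set S := ∫⁻ x in halfOpenCube a ℓ, ENNReal.ofReal (w x ^ (-1 / (r - 1)))
    have h4 : ENNReal.ofReal (Real.exp (s * m)) * ENNReal.ofReal (Real.exp (-(s * m))) = 1 := by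
      rw [← ENNReal.ofReal_mul (Real.exp_pos _).le, ← Real.exp_add]; simp
    have h5 : (4 : ℝ≥0∞) * 4 ^ (r - 1) = 4 ^ r := by
      conv_lhs => rw [← ENNReal.rpow_one 4, ← ENNReal.rpow_mul, one_mul,
        ← ENNReal.rpow_add _ _ (by norm_num) (by norm_num)]
      congr 1; ring
    calc _ = (ENNReal.ofReal (Real.exp (s * m)) * ENNReal.ofReal (Real.exp (-(s * m)))) *
          (4 * 4 ^ (r - 1)) * (W * S ^ (r - 1)) := by ring
      _ ≤ 4 ^ r * (muckenhouptChar r w * volume (halfOpenCube a ℓ) ^ r) := by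
          rw [h4, h5, one_mul]; gcongr
      _ = _ := by ring
  refine ⟨⟨isWeight_of_setLIntegral_ne_top (by fun_prop)
    (hw.1.2.mono fun x hx => by positivity) fun a ℓ hℓ => ?_, hle.trans_lt ?_⟩, hle⟩
  · refine ne_top_of_le_ne_top ?_ (h1 a ℓ hℓ)
    exact ENNReal.mul_ne_top ENNReal.ofReal_ne_top
      (ENNReal.mul_ne_top (by norm_num) (setLIntegral_weight_ne_top hw.1 a ℓ))
  · exact ENNReal.mul_lt_top (ENNReal.rpow_lt_top_of_nonneg (by linarith) (by norm_num)) hw.2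

/-- Undo the perturbation with `-s`. This is admissible when the perturbed characteristic is the
smaller one, as the allowed width then only grows; otherwise nothing is to prove. -/
theorem muckenhouptChar_le_exp_mul (hr : 1 < r) (hw : IsMuckenhoupt r w) (hB : 0 < B)
    (hβ : HasOscBound β B) (hs : |s| * B ≤
      perturbationConstant d r * (muckenhouptChar r w).toReal ^ (-transferExponent r)) :
    muckenhouptChar r w ≤ 4 ^ r * muckenhouptChar r (fun x => Real.exp (s * β x) * w x) := by
  obtain ⟨hw', -⟩ := hw.exp_mul hr hB hβ hs
  set w' := fun x => Real.exp (s * β x) * w x with hw'_def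
  rcases le_total (muckenhouptChar r w) (muckenhouptChar r w') with h | h
  · refine h.trans (le_mul_of_one_le_left' ?_)
    exact ENNReal.one_le_rpow (by norm_num) (by linarith)
  · have h' := ENNReal.toReal_mono hw.2.ne h
    have h1 := one_le_toReal_muckenhouptChar hr hw'
    have := (hw'.exp_mul hr hB hβ (s := -s) (by
      rw [abs_neg]
      refine hs.trans (mul_le_mul_of_nonneg_left ?_ (perturbationConstant_pos d r).le)
      exact Real.rpow_le_rpow_of_nonpos (by linarith) h'
        (neg_nonpos.2 (transferExponent_pos r).le))).2
    convert this using 2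
    funext x
    rw [hw'_def]
    simp only
    rw [← mul_assoc, ← Real.exp_add]
    simp

/-- Since `α` may be negative, both directions of the comparison of characteristics are needed. -/
theorem muckenhouptChar_exp_mul_rpow_le (hr : 1 < r) (hw : IsMuckenhoupt r w) (hB : 0 < B)
    (hβ : HasOscBound β B) (hs : |s| * B ≤
      perturbationConstant d r * (muckenhouptChar r w).toReal ^ (-transferExponent r)) (α : ℝ) :
    muckenhouptChar r (fun x => Real.exp (s * β x) * w x) ^ α ≤
      4 ^ (r * |α|) * muckenhouptChar r w ^ α := by
  have h1 := (hw.exp_mul hr hB hβ hs).2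
  have h2 := muckenhouptChar_le_exp_mul hr hw hB hβ hs
  have h4 : (4 : ℝ≥0∞) ^ r ≠ 0 := by simp
  have h4' : (4 : ℝ≥0∞) ^ r ≠ ∞ := by simp
  rw [ENNReal.rpow_mul]
  rcases le_total 0 α with h | h
  · rw [abs_of_nonneg h, ← ENNReal.mul_rpow_of_nonneg _ _ h]
    exact ENNReal.rpow_le_rpow h1 h
  · rw [abs_of_nonpos h]
    have h3 := ENNReal.rpow_le_rpow h2 (neg_nonneg.2 h)
    rw [ENNReal.mul_rpow_of_nonneg _ _ (neg_nonneg.2 h), ENNReal.rpow_neg,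
      ENNReal.rpow_neg _ α] at h3
    rw [ENNReal.rpow_neg] at h3 ⊢
    have h5 : (4 ^ r : ℝ≥0∞) ^ α ≠ 0 := by simp
    have h6 : (4 ^ r : ℝ≥0∞) ^ α ≠ ∞ := by simp
    rw [ENNReal.inv_le_iff_inv_le] at h3
    rw [ENNReal.mul_inv (by simp) (by simp), inv_inv, inv_inv] at h3
    calc _ = ((4 ^ r : ℝ≥0∞) ^ α)⁻¹ * ((4 ^ r : ℝ≥0∞) ^ α *
          muckenhouptChar r (fun x => Real.exp (s * β x) * w x) ^ α) := by
          rw [← mul_assoc, ENNReal.inv_mul_cancel h5 h6, one_mul]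
      _ ≤ _ := by gcongr

end

end

/-! ### The commutator as a derivative: Cauchy's estimate for bilinear maps -/

noncomputable section

section AbstractCommutator

/-- At `z = 0` the derivative is `b G 1 - b 1 G`, the abstract commutator. -/
theorem hasDerivAt_bilin_exp {𝔸 : Type*} [NormedRing 𝔸] [NormedAlgebra ℂ 𝔸] [CompleteSpace 𝔸]
    (b : 𝔸 →L[ℂ] 𝔸 →L[ℂ] ℂ) (G : 𝔸) (z : ℂ) :
    HasDerivAt (fun z : ℂ => b (NormedSpace.exp (z • G)) (NormedSpace.exp (z • -G)))
      (b (NormedSpace.exp (z • G) * G) (NormedSpace.exp (z • -G)) +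
        b (NormedSpace.exp (z • G)) (NormedSpace.exp (z • -G) * -G)) z := by
  have h1 := b.hasFDerivAt.comp_hasDerivAt z (hasDerivAt_exp_smul_const G z)
  have h2 := hasDerivAt_exp_smul_const (-G) z
  exact h1.clm_apply h2

variable {K : Type*} [TopologicalSpace K]

/-- The real part of a continuous function. -/
def reMap (P : C(K, ℂ)) : C(K, ℝ) := ⟨fun x => (P x).re, by fun_prop⟩

/-- The imaginary part of a continuous function. -/
def imMap (P : C(K, ℂ)) : C(K, ℝ) := ⟨fun x => (P x).im, by fun_prop⟩

theorem reMap_add (P Q : C(K, ℂ)) : reMap (P + Q) = reMap P + reMap Q := by ext; simp [reMap]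

theorem imMap_add (P Q : C(K, ℂ)) : imMap (P + Q) = imMap P + imMap Q := by ext; simp [imMap]

theorem reMap_smul (c : ℂ) (P : C(K, ℂ)) :
    reMap (c • P) = c.re • reMap P - c.im • imMap P := by ext; simp [reMap, imMap]

theorem imMap_smul (c : ℂ) (P : C(K, ℂ)) :
    imMap (c • P) = c.re • imMap P + c.im • reMap P := by ext; simp [reMap, imMap]

/-- The complex bilinear extension of a real bilinear form on real continuous functions. -/
def complexBilin (τ : C(K, ℝ) →ₗ[ℝ] C(K, ℝ) →ₗ[ℝ] ℝ) :
    C(K, ℂ) →ₗ[ℂ] C(K, ℂ) →ₗ[ℂ] ℂ :=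
  LinearMap.mk₂ ℂ
    (fun P Q => (⟨τ (reMap P) (reMap Q) - τ (imMap P) (imMap Q),
      τ (reMap P) (imMap Q) + τ (imMap P) (reMap Q)⟩ : ℂ))
    (fun P P' Q => by
      apply Complex.ext <;> simp [reMap_add, imMap_add] <;> ring)
    (fun c P Q => by
      apply Complex.ext <;> simp [reMap_smul, imMap_smul] <;> ring)
    (fun P Q Q' => by
      apply Complex.ext <;> simp [reMap_add, imMap_add] <;> ring)
    (fun c P Q => by
      apply Complex.ext <;> simp [reMap_smul, imMap_smul] <;> ring)

theorem norm_complexBilin_le (τ : C(K, ℝ) →ₗ[ℝ] C(K, ℝ) →ₗ[ℝ] ℝ) (P Q : C(K, ℂ)) {M : ℝ}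
    (h1 : |τ (reMap P) (reMap Q)| ≤ M) (h2 : |τ (imMap P) (imMap Q)| ≤ M)
    (h3 : |τ (reMap P) (imMap Q)| ≤ M) (h4 : |τ (imMap P) (reMap Q)| ≤ M) :
    ‖complexBilin τ P Q‖ ≤ 4 * M := by
  refine (Complex.norm_le_abs_re_add_abs_im _).trans ?_
  have h5 := abs_sub (τ (reMap P) (reMap Q)) (τ (imMap P) (imMap Q))
  have h6 := abs_add_le (τ (reMap P) (imMap Q)) (τ (imMap P) (reMap Q))
  simp only [complexBilin, LinearMap.mk₂_apply]
  linarith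

/-- The function `exp (s g)`. -/
def expMap (g : C(K, ℝ)) (s : ℝ) : C(K, ℝ) := ⟨fun x => Real.exp (s * g x), by fun_prop⟩

/-- A real continuous function as a complex one. -/
def ofRealMap (g : C(K, ℝ)) : C(K, ℂ) := ⟨fun x => (g x : ℂ), by fun_prop⟩

theorem complexBilin_commutator (τ : C(K, ℝ) →ₗ[ℝ] C(K, ℝ) →ₗ[ℝ] ℝ) (g : C(K, ℝ)) :
    complexBilin τ (ofRealMap g) 1 - complexBilin τ 1 (ofRealMap g) =
      ((τ g 1 - τ 1 g : ℝ) : ℂ) := by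
  have hre : reMap (ofRealMap g) = g := by ext; simp [reMap, ofRealMap]
  have him : imMap (ofRealMap g) = 0 := by ext; simp [imMap, ofRealMap]
  have hre1 : reMap (1 : C(K, ℂ)) = 1 := by ext; simp [reMap]
  have him1 : imMap (1 : C(K, ℂ)) = 0 := by ext; simp [imMap]
  apply Complex.ext <;> simp [complexBilin, hre, him, hre1, him1]

variable [CompactSpace K]

theorem norm_reMap_le (P : C(K, ℂ)) : ‖reMap P‖ ≤ ‖P‖ :=
  (ContinuousMap.norm_le _ (norm_nonneg P)).2 fun x =>
    (Complex.abs_re_le_norm (P x)).trans (P.norm_coe_le_norm x)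

theorem norm_imMap_le (P : C(K, ℂ)) : ‖imMap P‖ ≤ ‖P‖ :=
  (ContinuousMap.norm_le _ (norm_nonneg P)).2 fun x =>
    (Complex.abs_im_le_norm (P x)).trans (P.norm_coe_le_norm x)

theorem exp_continuousMap_apply (G : C(K, ℂ)) (x : K) :
    NormedSpace.exp G x = Complex.exp (G x) := by
  rw [Complex.exp_eq_exp_ℂ]
  exact NormedSpace.map_exp (ContinuousMap.evalStarAlgHom ℂ ℂ x) (continuous_eval_const x) G

/-- Writing `e^{zg} = e^{(Re z) g} (cos + i sin)` leaves real terms whose oscillating factors have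
norm at most `1`; the multipliers `u` and `v` stand for these factors. -/
theorem norm_complexBilin_exp_le (τ : C(K, ℝ) →ₗ[ℝ] C(K, ℝ) →ₗ[ℝ] ℝ) (g : C(K, ℝ)) (z : ℂ)
    {M : ℝ} (h : ∀ u v : C(K, ℝ), ‖u‖ ≤ 1 → ‖v‖ ≤ 1 →
      |τ (expMap g z.re * u) (expMap g (-z.re) * v)| ≤ M) :
    ‖complexBilin τ (NormedSpace.exp (z • ofRealMap g)) (NormedSpace.exp (z • -ofRealMap g))‖ ≤
      4 * M := by
  let co : C(K, ℝ) := ⟨fun x => Real.cos (z.im * g x), by fun_prop⟩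
  let si : C(K, ℝ) := ⟨fun x => Real.sin (z.im * g x), by fun_prop⟩
  have hco : ‖co‖ ≤ 1 := (ContinuousMap.norm_le _ zero_le_one).2 fun x => Real.abs_cos_le_one _
  have hsi : ‖si‖ ≤ 1 := (ContinuousMap.norm_le _ zero_le_one).2 fun x => Real.abs_sin_le_one _
  have hsi' : ‖-si‖ ≤ 1 := by rwa [norm_neg]
  have e1 : reMap (NormedSpace.exp (z • ofRealMap g)) = expMap g z.re * co := by
    ext x
    simp [reMap, exp_continuousMap_apply, Complex.exp_re, ofRealMap, expMap, co]
  have e2 : imMap (NormedSpace.exp (z • ofRealMap g)) = expMap g z.re * si := by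
    ext x
    simp [imMap, exp_continuousMap_apply, Complex.exp_im, ofRealMap, expMap, si]
  have e3 : reMap (NormedSpace.exp (z • -ofRealMap g)) = expMap g (-z.re) * co := by
    ext x
    simp [reMap, exp_continuousMap_apply, Complex.exp_re, ofRealMap, expMap, co]
  have e4 : imMap (NormedSpace.exp (z • -ofRealMap g)) = expMap g (-z.re) * -si := by
    ext x
    simp [imMap, exp_continuousMap_apply, Complex.exp_im, ofRealMap, expMap, si]
  refine norm_complexBilin_le τ _ _ ?_ ?_ ?_ ?_
  · rw [e1, e3]; exact h _ _ hco hco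
  · rw [e2, e4]; exact h _ _ hsi hsi'
  · rw [e1, e4]; exact h _ _ hco hsi'
  · rw [e2, e3]; exact h _ _ hsi hco

/-- Cauchy's estimate on the circle of radius `ε`. The bound `M₀` only provides continuity, hence
holomorphy, and does not enter the conclusion. -/
theorem abs_bilin_commutator_le (τ : C(K, ℝ) →ₗ[ℝ] C(K, ℝ) →ₗ[ℝ] ℝ) {M₀ : ℝ} (hM₀ : 0 ≤ M₀)
    (hτ : ∀ p q, |τ p q| ≤ M₀ * (‖p‖ * ‖q‖)) (g : C(K, ℝ)) {ε M : ℝ} (hε : 0 < ε)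
    (h : ∀ s : ℝ, |s| ≤ ε → ∀ u v : C(K, ℝ), ‖u‖ ≤ 1 → ‖v‖ ≤ 1 →
      |τ (expMap g s * u) (expMap g (-s) * v)| ≤ M) :
    |τ g 1 - τ 1 g| ≤ 4 * M / ε := by
  obtain ⟨b, hb⟩ : ∃ b : C(K, ℂ) →L[ℂ] C(K, ℂ) →L[ℂ] ℂ, ∀ P Q, b P Q = complexBilin τ P Q := by
    have hbd : ∀ {P Q : C(K, ℂ)} {p q : C(K, ℝ)}, ‖p‖ ≤ ‖P‖ → ‖q‖ ≤ ‖Q‖ →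
        |τ p q| ≤ M₀ * (‖P‖ * ‖Q‖) := fun {P Q p q} hp hq => (hτ p q).trans (by gcongr)
    refine ⟨(complexBilin τ).mkContinuous₂ (4 * M₀) fun P Q => ?_, fun P Q => rfl⟩
    rw [mul_assoc, mul_assoc]
    exact norm_complexBilin_le τ P Q (hbd (norm_reMap_le P) (norm_reMap_le Q))
      (hbd (norm_imMap_le P) (norm_imMap_le Q)) (hbd (norm_reMap_le P) (norm_imMap_le Q))
      (hbd (norm_imMap_le P) (norm_reMap_le Q))
  have hcauchy := Complex.norm_deriv_le_of_forall_mem_sphere_norm_le (c := 0) (C := 4 * M) hε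
    (Differentiable.diffContOnCl fun z => (hasDerivAt_bilin_exp b (ofRealMap g) z).differentiableAt)
    fun z hz => by
      have hz : ‖z‖ = ε := by simpa using hz
      rw [hb]
      exact norm_complexBilin_exp_le τ g z (h z.re (hz ▸ Complex.abs_re_le_norm z))
  rwa [(hasDerivAt_bilin_exp b (ofRealMap g) 0).deriv, zero_smul, zero_smul, NormedSpace.exp_zero,
    one_mul, one_mul, map_neg, hb, hb, ← sub_eq_add_neg, complexBilin_commutator,
    Complex.norm_real] at hcauchy

/-- A norming functional reduces to scalar values, so `X` needs only a real structure. -/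
theorem norm_bilin_commutator_le {X : Type*} [NormedAddCommGroup X] [NormedSpace ℝ X]
    (σ : C(K, ℝ) →ₗ[ℝ] C(K, ℝ) →ₗ[ℝ] X) {M₀ : ℝ} (hM₀ : 0 ≤ M₀)
    (hσ : ∀ p q, ‖σ p q‖ ≤ M₀ * (‖p‖ * ‖q‖)) (g : C(K, ℝ)) {ε M : ℝ} (hε : 0 < ε)
    (h : ∀ s : ℝ, |s| ≤ ε → ∀ u v : C(K, ℝ), ‖u‖ ≤ 1 → ‖v‖ ≤ 1 →
      ‖σ (expMap g s * u) (expMap g (-s) * v)‖ ≤ M) :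
    ‖σ g 1 - σ 1 g‖ ≤ 4 * M / ε := by
  obtain ⟨φ, hφ, hφx⟩ := exists_dual_vector'' ℝ (σ g 1 - σ 1 g)
  have hφle : ∀ x, |φ x| ≤ ‖x‖ := fun x => by
    simpa using (φ.le_opNorm x).trans (mul_le_of_le_one_left (norm_nonneg x) hφ)
  have h1 := abs_bilin_commutator_le (σ.compr₂ φ.toLinearMap) hM₀
    (fun p q => (hφle _).trans (hσ p q)) g hε
    (fun s hs u v hu hv => (hφle _).trans (h s hs u v hu hv))
  have h2 : φ (σ g 1) - φ (σ 1 g) = ‖σ g 1 - σ 1 g‖ := by rw [← map_sub]; exact hφx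
  rw [← abs_of_nonneg (norm_nonneg (σ g 1 - σ 1 g)), ← h2]
  exact h1

end AbstractCommutator
end

/-! ### Weighted norms and multiplication by functions of the symbol -/

noncomputable section
variable {d : ℕ} {𝕜 : Type*} [RCLike 𝕜] {r : ℝ} {w w' : (Fin d → ℝ) → ℝ}

theorem weightedNorm_eq_lintegral (hr : 1 < r) (hw : AEMeasurable w volume)
    (g : (Fin d → ℝ) →ₘ[volume] 𝕜) :
    weightedNorm r w g =
      (∫⁻ x, ENNReal.ofReal (‖g x‖ ^ r * w x)) ^ (1 / r) := by
  have hr0 : 0 < r := by linarith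
  have hg := g.aestronglyMeasurable.enorm
  rw [weightedNorm, eLpNorm_eq_lintegral_rpow_enorm_toReal (by simpa using hr0)
    ENNReal.ofReal_ne_top, ENNReal.toReal_ofReal hr0.le,
    lintegral_withDensity_eq_lintegral_mul₀ hw.ennreal_ofReal (by fun_prop)]
  congr 1
  refine lintegral_congr fun x => ?_
  rw [Pi.mul_apply, ENNReal.ofReal_mul (by positivity), mul_comm,
    ← ENNReal.ofReal_rpow_of_nonneg (norm_nonneg _) hr0.le, ofReal_norm]

theorem weightedNorm_le_of_ae_le (hr : 1 < r) (hw : AEMeasurable w volume)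
    (hw' : AEMeasurable w' volume) {g g' : (Fin d → ℝ) →ₘ[volume] 𝕜} {c : ℝ} (hc : 0 ≤ c)
    (h : ∀ᵐ x, ‖g x‖ ^ r * w x ≤ (c * ‖g' x‖) ^ r * w' x) :
    weightedNorm r w g ≤ ENNReal.ofReal c * weightedNorm r w' g' := by
  have hr0 : 0 < r := by linarith
  rw [weightedNorm_eq_lintegral hr hw, weightedNorm_eq_lintegral hr hw']
  have h1 : ENNReal.ofReal c = (ENNReal.ofReal c ^ r) ^ (1 / r) := by
    rw [← ENNReal.rpow_mul, mul_one_div_cancel hr0.ne', ENNReal.rpow_one]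
  rw [h1, ← ENNReal.mul_rpow_of_nonneg _ _ (by positivity)]
  refine ENNReal.rpow_le_rpow ?_ (by positivity)
  rw [← lintegral_const_mul' _ _ (by simp [hr0.le])]
  refine lintegral_mono_ae ?_
  filter_upwards [h] with x hx
  rw [ENNReal.ofReal_rpow_of_nonneg hc hr0.le, ← ENNReal.ofReal_mul (by positivity), ← mul_assoc,
    ← Real.mul_rpow hc (norm_nonneg _)]
  exact ENNReal.ofReal_le_ofReal hx

theorem memLp_of_weightedNorm_lt_top {g : (Fin d → ℝ) →ₘ[volume] 𝕜} (h : weightedNorm r w g < ∞) :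
    MemLp g (ENNReal.ofReal r) (weightMeasure w) :=
  ⟨g.aestronglyMeasurable.mono_ac (weightMeasure_absolutelyContinuous w), h⟩

/-- A function with finite weighted norm as an element of the weighted Lebesgue space. -/
def toWeightedLp (g : (Fin d → ℝ) →ₘ[volume] 𝕜) (h : weightedNorm r w g < ∞) :
    Lp 𝕜 (ENNReal.ofReal r) (weightMeasure w) :=
  (memLp_of_weightedNorm_lt_top h).toLp g

theorem norm_toWeightedLp (g : (Fin d → ℝ) →ₘ[volume] 𝕜) (h : weightedNorm r w g < ∞) :
    ‖toWeightedLp g h‖ = (weightedNorm r w g).toReal :=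
  Lp.norm_toLp _ _

theorem toWeightedLp_add {g g₁ g₂ : (Fin d → ℝ) →ₘ[volume] 𝕜} (h : weightedNorm r w g < ∞)
    (h₁ : weightedNorm r w g₁ < ∞) (h₂ : weightedNorm r w g₂ < ∞) (hg : g = g₁ + g₂) :
    toWeightedLp g h = toWeightedLp g₁ h₁ + toWeightedLp g₂ h₂ := by
  subst hg
  rw [toWeightedLp, toWeightedLp, toWeightedLp, ← MemLp.toLp_add]
  exact MemLp.toLp_congr _ _ ((weightMeasure_absolutelyContinuous w).ae_le (AEEqFun.coeFn_add _ _))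

theorem toWeightedLp_sub {g g₁ g₂ : (Fin d → ℝ) →ₘ[volume] 𝕜} (h : weightedNorm r w g < ∞)
    (h₁ : weightedNorm r w g₁ < ∞) (h₂ : weightedNorm r w g₂ < ∞) (hg : g = g₁ - g₂) :
    toWeightedLp g h = toWeightedLp g₁ h₁ - toWeightedLp g₂ h₂ :=
  eq_sub_of_add_eq (toWeightedLp_add h₁ h h₂ (by rw [hg, sub_add_cancel])).symm

theorem toWeightedLp_smul {g g₁ : (Fin d → ℝ) →ₘ[volume] 𝕜} (h : weightedNorm r w g < ∞)
    (h₁ : weightedNorm r w g₁ < ∞) (c : ℝ) (hg : g = (c : 𝕜) • g₁) :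
    toWeightedLp g h = c • toWeightedLp g₁ h₁ := by
  subst hg
  rw [RCLike.real_smul_eq_coe_smul (K := 𝕜), toWeightedLp, toWeightedLp, ← MemLp.toLp_const_smul]
  exact MemLp.toLp_congr _ _
    ((weightMeasure_absolutelyContinuous w).ae_le (AEEqFun.coeFn_smul _ _))

theorem weightedNorm_add_le (hr : 1 < r) (g₁ g₂ : (Fin d → ℝ) →ₘ[volume] 𝕜) :
    weightedNorm r w (g₁ + g₂) ≤ weightedNorm r w g₁ + weightedNorm r w g₂ := by
  have hac := weightMeasure_absolutelyContinuous w
  rw [weightedNorm, eLpNorm_congr_ae (hac.ae_le (AEEqFun.coeFn_add g₁ g₂))]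
  exact eLpNorm_add_le (g₁.aestronglyMeasurable.mono_ac hac)
    (g₂.aestronglyMeasurable.mono_ac hac) (by simpa using hr.le)

theorem weightedNorm_sub_le (hr : 1 < r) (g₁ g₂ : (Fin d → ℝ) →ₘ[volume] 𝕜) :
    weightedNorm r w (g₁ - g₂) ≤ weightedNorm r w g₁ + weightedNorm r w g₂ := by
  have hac := weightMeasure_absolutelyContinuous w
  rw [weightedNorm, eLpNorm_congr_ae (hac.ae_le (AEEqFun.coeFn_sub g₁ g₂))]
  exact eLpNorm_sub_le (g₁.aestronglyMeasurable.mono_ac hac)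
    (g₂.aestronglyMeasurable.mono_ac hac) (by simpa using hr.le)

theorem aeEqFun_mul_add (m g₁ g₂ : (Fin d → ℝ) →ₘ[volume] 𝕜) :
    m * (g₁ + g₂) = m * g₁ + m * g₂ :=
  (mulOperator m).map_add g₁ g₂

theorem aeEqFun_add_mul (m₁ m₂ g : (Fin d → ℝ) →ₘ[volume] 𝕜) :
    (m₁ + m₂) * g = m₁ * g + m₂ * g := by
  rw [mul_comm, aeEqFun_mul_add, mul_comm g, mul_comm g]

theorem aeEqFun_mul_smul (c : 𝕜) (m g : (Fin d → ℝ) →ₘ[volume] 𝕜) :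
    m * (c • g) = c • (m * g) :=
  (mulOperator m).map_smul c g

theorem aeEqFun_smul_mul (c : 𝕜) (m g : (Fin d → ℝ) →ₘ[volume] 𝕜) :
    (c • m) * g = c • (m * g) := by
  rw [mul_comm, aeEqFun_mul_smul, mul_comm]

theorem LinearPMap.apply_add_of_eq {R E F : Type*} [Ring R] [AddCommGroup E] [AddCommGroup F]
    [Module R E] [Module R F] (T : E →ₗ.[R] F) {x y z : E} (hx : x ∈ T.domain) (hy : y ∈ T.domain)
    (hz : z ∈ T.domain) (h : x = y + z) : T ⟨x, hx⟩ = T ⟨y, hy⟩ + T ⟨z, hz⟩ := by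
  subst h
  exact T.map_add ⟨y, hy⟩ ⟨z, hz⟩

theorem LinearPMap.apply_smul_of_eq {R E F : Type*} [Ring R] [AddCommGroup E] [AddCommGroup F]
    [Module R E] [Module R F] (T : E →ₗ.[R] F) {x y : E} (hx : x ∈ T.domain) (hy : y ∈ T.domain)
    (c : R) (h : x = c • y) : T ⟨x, hx⟩ = c • T ⟨y, hy⟩ := by
  subst h
  exact T.map_smul c ⟨y, hy⟩

/-- The function `ψ ∘ b` with values in `𝕜`, for continuous real `ψ`. -/
def realSymbol (b : (Fin d → ℝ) →ₘ[volume] 𝕜) (ψ : C(𝕜, ℝ)) : (Fin d → ℝ) →ₘ[volume] 𝕜 :=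
  b.comp (fun z => (ψ z : 𝕜)) (by fun_prop)

theorem coeFn_realSymbol (b : (Fin d → ℝ) →ₘ[volume] 𝕜) (ψ : C(𝕜, ℝ)) :
    realSymbol b ψ =ᵐ[volume] fun x => (ψ (b x) : 𝕜) :=
  AEEqFun.coeFn_comp _ _ _

theorem coeFn_realSymbol_mul (b : (Fin d → ℝ) →ₘ[volume] 𝕜) (ψ : C(𝕜, ℝ))
    (g : (Fin d → ℝ) →ₘ[volume] 𝕜) :
    (realSymbol b ψ * g : (Fin d → ℝ) →ₘ[volume] 𝕜) =ᵐ[volume] fun x => (ψ (b x) : 𝕜) * g x := by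
  filter_upwards [AEEqFun.coeFn_mul (realSymbol b ψ) g, coeFn_realSymbol b ψ] with x h1 h2
  rw [h1, Pi.mul_apply, h2]

theorem realSymbol_add (b : (Fin d → ℝ) →ₘ[volume] 𝕜) (ψ₁ ψ₂ : C(𝕜, ℝ)) :
    realSymbol b (ψ₁ + ψ₂) = realSymbol b ψ₁ + realSymbol b ψ₂ := by
  refine AEEqFun.ext ?_
  filter_upwards [AEEqFun.coeFn_add (realSymbol b ψ₁) (realSymbol b ψ₂), coeFn_realSymbol b ψ₁,
    coeFn_realSymbol b ψ₂, coeFn_realSymbol b (ψ₁ + ψ₂)] with x h1 h2 h3 h4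
  rw [h1, h4, Pi.add_apply, h2, h3]
  simp

theorem realSymbol_smul (b : (Fin d → ℝ) →ₘ[volume] 𝕜) (c : ℝ) (ψ : C(𝕜, ℝ)) :
    realSymbol b (c • ψ) = (c : 𝕜) • realSymbol b ψ := by
  refine AEEqFun.ext ?_
  filter_upwards [AEEqFun.coeFn_smul (c : 𝕜) (realSymbol b ψ), coeFn_realSymbol b ψ,
    coeFn_realSymbol b (c • ψ)] with x h1 h2 h3
  rw [h1, h3, Pi.smul_apply, h2]
  simp

theorem realSymbol_one (b : (Fin d → ℝ) →ₘ[volume] 𝕜) : realSymbol b 1 = 1 := by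
  refine AEEqFun.ext ?_
  filter_upwards [coeFn_realSymbol b 1, AEEqFun.coeFn_one (α := Fin d → ℝ) (μ := volume) (β := 𝕜)]
    with x h1 h2
  rw [h1, h2]
  simp

/-- Multiplication by `ψ ∘ b` is bounded between weighted spaces when `|ψ ∘ b|` is dominated
by the ratio of the weights. -/
theorem weightedNorm_realSymbol_mul_le (hr : 1 < r) (hw : AEMeasurable w volume)
    (hw' : AEMeasurable w' volume) (b g : (Fin d → ℝ) →ₘ[volume] 𝕜) (ψ : C(𝕜, ℝ)) {c : ℝ}
    (hc : 0 ≤ c) (h : ∀ᵐ x, |ψ (b x)| ^ r * w x ≤ c ^ r * w' x) :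
    weightedNorm r w (realSymbol b ψ * g) ≤ ENNReal.ofReal c * weightedNorm r w' g := by
  refine weightedNorm_le_of_ae_le hr hw hw' hc ?_
  filter_upwards [coeFn_realSymbol_mul b ψ g, h] with x h1 h2
  rw [h1, norm_mul, RCLike.norm_ofReal, Real.mul_rpow (abs_nonneg _) (norm_nonneg _),
    Real.mul_rpow hc (norm_nonneg _)]
  have : 0 ≤ ‖g x‖ ^ r := by positivity
  nlinarith

end

/-! ### Commutators with truncated symbols -/

noncomputable section
variable {d : ℕ} {𝕜 : Type*} [RCLike 𝕜] {r : ℝ} {w w' : (Fin d → ℝ) → ℝ}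

section Sandwich

variable {K : Type*} [TopologicalSpace K] [CompactSpace K]
  {T : ((Fin d → ℝ) →ₘ[volume] 𝕜) →ₗ.[𝕜] ((Fin d → ℝ) →ₘ[volume] 𝕜)}

theorem weightedNorm_realSymbol_comp_mul_le (hr : 1 < r) (hw : IsWeight w)
    (b g : (Fin d → ℝ) →ₘ[volume] 𝕜) (ρ : C(𝕜, K)) (p : C(K, ℝ)) :
    weightedNorm r w (realSymbol b (p.comp ρ) * g) ≤ ENNReal.ofReal ‖p‖ * weightedNorm r w g := by
  have hwm := aemeasurable_of_isWeight hw
  refine weightedNorm_realSymbol_mul_le hr hwm hwm b g _ (norm_nonneg p) ?_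
  filter_upwards [hw.2] with x hx
  gcongr
  exact p.norm_coe_le_norm _

/-- The bilinear map `(p, q) ↦ p T (q f)`, where `p` and `q` are functions of `b`. -/
theorem exists_sandwich (hr : 1 < r) [Fact (1 ≤ ENNReal.ofReal r)] (hw : IsWeight w) {D : ℝ≥0∞}
    (hD : D ≠ ∞) (hT : ∀ g, weightedNorm r w g < ∞ →
      ∃ hg : g ∈ T.domain, weightedNorm r w (T ⟨g, hg⟩) ≤ D * weightedNorm r w g)
    (b f : (Fin d → ℝ) →ₘ[volume] 𝕜) (hf : weightedNorm r w f < ∞) (ρ : C(𝕜, K)) :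
    ∃ σ : C(K, ℝ) →ₗ[ℝ] C(K, ℝ) →ₗ[ℝ] Lp 𝕜 (ENNReal.ofReal r) (weightMeasure w),
      (∀ p q, ‖σ p q‖ ≤ (D * weightedNorm r w f).toReal * (‖p‖ * ‖q‖)) ∧
      ∀ p q : C(K, ℝ), ∃ (hq : realSymbol b (q.comp ρ) * f ∈ T.domain)
        (h : weightedNorm r w (realSymbol b (p.comp ρ) *
          T ⟨realSymbol b (q.comp ρ) * f, hq⟩) < ∞), σ p q = toWeightedLp _ h := by
  have hmul := fun (p : C(K, ℝ)) g => weightedNorm_realSymbol_comp_mul_le hr hw b g ρ p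
  have hfin : ∀ q : C(K, ℝ), weightedNorm r w (realSymbol b (q.comp ρ) * f) < ∞ := fun q =>
    (hmul q f).trans_lt (ENNReal.mul_lt_top ENNReal.ofReal_lt_top hf)
  choose hdom hTle using fun q => hT _ (hfin q)
  have hbd : ∀ p q : C(K, ℝ), weightedNorm r w (realSymbol b (p.comp ρ) *
      T ⟨realSymbol b (q.comp ρ) * f, hdom q⟩) ≤
        D * weightedNorm r w f * (ENNReal.ofReal ‖p‖ * ENNReal.ofReal ‖q‖) := by
    intro p q
    calc _ ≤ ENNReal.ofReal ‖p‖ * (D * (ENNReal.ofReal ‖q‖ * weightedNorm r w f)) :=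
          (hmul p _).trans (by gcongr; exact (hTle q).trans (by gcongr; exact hmul q f))
      _ = _ := by ring
  have htop : ∀ p q : C(K, ℝ), D * weightedNorm r w f *
      (ENNReal.ofReal ‖p‖ * ENNReal.ofReal ‖q‖) < ∞ := fun p q =>
    ENNReal.mul_lt_top (ENNReal.mul_lt_top hD.lt_top hf)
      (ENNReal.mul_lt_top ENNReal.ofReal_lt_top ENNReal.ofReal_lt_top)
  have hfin2 := fun p q => (hbd p q).trans_lt (htop p q)
  have hcomp_add : ∀ p p' : C(K, ℝ), (p + p').comp ρ = p.comp ρ + p'.comp ρ := fun _ _ => rfl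
  have hcomp_smul : ∀ (c : ℝ) (p : C(K, ℝ)), (c • p).comp ρ = c • p.comp ρ := fun _ _ => rfl
  have hTadd : ∀ q q' : C(K, ℝ), T ⟨realSymbol b ((q + q').comp ρ) * f, hdom _⟩ =
      T ⟨realSymbol b (q.comp ρ) * f, hdom _⟩ + T ⟨realSymbol b (q'.comp ρ) * f, hdom _⟩ := by
    intro q q'
    exact T.apply_add_of_eq _ _ _ (by rw [hcomp_add, realSymbol_add, aeEqFun_add_mul])
  have hTsmul : ∀ (c : ℝ) (q : C(K, ℝ)), T ⟨realSymbol b ((c • q).comp ρ) * f, hdom _⟩ =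
      (c : 𝕜) • T ⟨realSymbol b (q.comp ρ) * f, hdom _⟩ := by
    intro c q
    exact T.apply_smul_of_eq _ _ _ (by rw [hcomp_smul, realSymbol_smul, aeEqFun_smul_mul])
  refine ⟨LinearMap.mk₂ ℝ (fun p q => toWeightedLp _ (hfin2 p q)) ?_ ?_ ?_ ?_, ?_, ?_⟩
  · intro p p' q
    exact toWeightedLp_add _ _ _ (by rw [hcomp_add, realSymbol_add, aeEqFun_add_mul])
  · intro c p q
    exact toWeightedLp_smul _ _ _ (by rw [hcomp_smul, realSymbol_smul, aeEqFun_smul_mul])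
  · intro p q q'
    exact toWeightedLp_add _ _ _ (by rw [hTadd, aeEqFun_mul_add])
  · intro c p q
    exact toWeightedLp_smul _ _ _ (by rw [hTsmul, aeEqFun_mul_smul])
  · intro p q
    rw [LinearMap.mk₂_apply, norm_toWeightedLp]
    refine (ENNReal.toReal_mono (htop p q).ne (hbd p q)).trans (le_of_eq ?_)
    rw [ENNReal.toReal_mul, ENNReal.toReal_mul (a := ENNReal.ofReal ‖p‖), ENNReal.toReal_ofReal (norm_nonneg _),
      ENNReal.toReal_ofReal (norm_nonneg _)]
  · exact fun p q => ⟨hdom q, hfin2 p q, rfl⟩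

end Sandwich

/-- Truncation of a continuous function to `[-N, N]`. -/
def clampMap (φ : C(𝕜, ℝ)) (N : ℝ) : C(𝕜, ℝ) :=
  ⟨fun z => clamp N (φ z), (lipschitzWith_clamp N).continuous.comp φ.continuous⟩

/-- Truncation as a map to a compact space. -/
def projMap (φ : C(𝕜, ℝ)) {N : ℝ} (hN : -N ≤ N) : C(𝕜, Set.Icc (-N) N) :=
  ⟨fun z => Set.projIcc (-N) N hN (φ z), continuous_projIcc.comp φ.continuous⟩

theorem coe_projMap (φ : C(𝕜, ℝ)) {N : ℝ} (hN : -N ≤ N) (z : 𝕜) :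
    (projMap φ hN z : ℝ) = clamp N (φ z) := by
  simp [projMap, Set.coe_projIcc, clamp, min_comm]

/-- The bound of the commutator with `b` per unit of oscillation, without the power of the
characteristic. -/
def transferConstant (d : ℕ) (r α : ℝ) (C₀ : ℝ≥0) : ℝ≥0∞ :=
  ENNReal.ofReal (4 * r / perturbationConstant d r) * (C₀ * 4 ^ (r * |α|))

/-- The abstract commutator estimate, applied to the sandwich of `T` between functions of the
symbol. The truncation level `N` enters the bound only through the oscillation `B`. -/
theorem HasMuckenhouptBound.clamp_commutator_le (hr : 1 < r) {α : ℝ} {C₀ : ℝ≥0}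
    {T : ((Fin d → ℝ) →ₘ[volume] 𝕜) →ₗ.[𝕜] ((Fin d → ℝ) →ₘ[volume] 𝕜)}
    (hT : HasMuckenhouptBound T r α C₀) (hw : IsMuckenhoupt r w)
    (b f : (Fin d → ℝ) →ₘ[volume] 𝕜) (hf : weightedNorm r w f < ∞) {φ : C(𝕜, ℝ)} {B N : ℝ}
    (hB : 0 < B) (hN : 0 ≤ N) (hosc : HasOscBound (fun x => clamp N (φ (b x))) B) :
    ∃ (hf' : f ∈ T.domain) (hbf : realSymbol b (clampMap φ N) * f ∈ T.domain),
      weightedNorm r w (realSymbol b (clampMap φ N) * T ⟨f, hf'⟩ -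
        T ⟨realSymbol b (clampMap φ N) * f, hbf⟩) ≤
      transferConstant d r α C₀ * ENNReal.ofReal B *
        muckenhouptChar r w ^ (α + transferExponent r) * weightedNorm r w f := by
  have hr0 : 0 < r := by linarith
  have : Fact (1 ≤ ENNReal.ofReal r) := ⟨by simpa using hr.le⟩
  have hA1 := one_le_toReal_muckenhouptChar hr hw
  have hA0 : muckenhouptChar r w ≠ 0 := (one_pos.trans_le (one_le_muckenhouptChar hr hw.1)).ne'
  have hAt := hw.2.ne
  have hκ := perturbationConstant_pos d r
  have hwm := aemeasurable_of_isWeight hw.1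
  set A := muckenhouptChar r w with hA
  have hNN : -N ≤ N := by linarith
  set ρ := projMap φ hNN with hρ
  have hDt : (C₀ * A ^ α : ℝ≥0∞) ≠ ∞ :=
    ENNReal.mul_ne_top ENNReal.coe_ne_top (ENNReal.rpow_ne_top_of_ne_zero hA0 hAt)
  obtain ⟨σ, hσ, hσeq⟩ := exists_sandwich hr hw.1 hDt (hT w hw) b f hf ρ
  set M : ℝ≥0∞ := C₀ * (4 ^ (r * |α|) * A ^ α) * weightedNorm r w f with hM
  have hMt : M ≠ ∞ := by
    refine ENNReal.mul_ne_top (ENNReal.mul_ne_top ENNReal.coe_ne_top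
      (ENNReal.mul_ne_top ?_ (ENNReal.rpow_ne_top_of_ne_zero hA0 hAt))) hf.ne
    exact ENNReal.rpow_ne_top_of_nonneg (by positivity) (by norm_num)
  let g : C(Set.Icc (-N) N, ℝ) := ⟨Subtype.val, continuous_subtype_val⟩
  have hg : g.comp ρ = clampMap φ N := by
    ext z
    exact coe_projMap φ hNN z
  have h1 : (1 : C(Set.Icc (-N) N, ℝ)).comp ρ = 1 := rfl
  -- The largest radius allowed by the perturbation lemma; the factor `r` appears because
  -- multiplication by `e^{sb}` in `L^r` changes the weight by `e^{rsb}`.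
  set ε := perturbationConstant d r * A.toReal ^ (-transferExponent r) / (B * r) with hε
  have hε0 : 0 < ε := by positivity
  have hmain := norm_bilin_commutator_le σ ENNReal.toReal_nonneg hσ g hε0 (M := M.toReal) ?_
  · obtain ⟨hd1, hf1, he1⟩ := hσeq g 1
    obtain ⟨hd2, hf2, he2⟩ := hσeq 1 g
    simp only [hg, h1, realSymbol_one, one_mul] at hd1 hf1 he1 hd2 hf2 he2
    have hfin : weightedNorm r w (realSymbol b (clampMap φ N) * T ⟨f, hd1⟩ -
        T ⟨realSymbol b (clampMap φ N) * f, hd2⟩) < ∞ :=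
      (weightedNorm_sub_le hr _ _).trans_lt (ENNReal.add_lt_top.2 ⟨hf1, hf2⟩)
    refine ⟨hd1, hd2, ?_⟩
    rw [he1, he2, ← toWeightedLp_sub hfin hf1 hf2 rfl, norm_toWeightedLp] at hmain
    rw [← ENNReal.ofReal_toReal hfin.ne]
    refine (ENNReal.ofReal_le_ofReal hmain).trans (le_of_eq ?_)
    have e1 : 4 * M.toReal / ε = 4 * r / perturbationConstant d r * B *
        A.toReal ^ transferExponent r * M.toReal := by
      rw [hε, Real.rpow_neg (by positivity)]
      field_simp
    have e2 : ENNReal.ofReal (A.toReal ^ transferExponent r) = A ^ transferExponent r := by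
      rw [← ENNReal.ofReal_rpow_of_pos (by linarith), ENNReal.ofReal_toReal hAt]
    rw [e1, ENNReal.ofReal_mul (by positivity), ENNReal.ofReal_mul (by positivity),
      ENNReal.ofReal_mul (by positivity), e2, ENNReal.ofReal_toReal hMt, hM,
      ENNReal.rpow_add _ _ hA0 hAt, transferConstant]
    ring
  · intro s hs u v hu hv
    have hs' : |r * s| * B ≤ perturbationConstant d r * A.toReal ^ (-transferExponent r) := by
      rw [hε, le_div_iff₀ (by positivity)] at hs
      rw [abs_mul, abs_of_pos hr0]
      linarith
    have hw' := (hw.exp_mul hr hB hosc hs').1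
    have hA' := muckenhouptChar_exp_mul_rpow_le hr hw hB hosc hs' α
    set w' := fun x => Real.exp (r * s * clamp N (φ (b x))) * w x with hw'_def
    have hwm' := aemeasurable_of_isWeight hw'.1
    obtain ⟨hq, h, heq⟩ := hσeq (expMap g s * u) (expMap g (-s) * v)
    rw [heq, norm_toWeightedLp]
    refine ENNReal.toReal_mono hMt ?_
    have hval : ∀ (t : ℝ) (u : C(Set.Icc (-N) N, ℝ)), ‖u‖ ≤ 1 → ∀ z,
        |((expMap g t * u).comp ρ) z| ^ r ≤ Real.exp (r * t * clamp N (φ z)) := by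
      intro t u hu z
      have h1 : |((expMap g t * u).comp ρ) z| ≤ Real.exp (t * clamp N (φ z)) := by
        have h2 : |u (ρ z)| ≤ 1 := (u.norm_coe_le_norm _).trans hu
        have h3 : ((expMap g t * u).comp ρ) z = Real.exp (t * clamp N (φ z)) * u (ρ z) := by
          rw [← coe_projMap φ hNN]; rfl
        rw [h3, abs_mul, abs_of_pos (Real.exp_pos _)]
        exact mul_le_of_le_one_right (Real.exp_pos _).le h2
      refine (Real.rpow_le_rpow (abs_nonneg _) h1 hr0.le).trans (le_of_eq ?_)
      rw [← Real.exp_mul]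
      congr 1; ring
    -- The outer multiplier maps `L^r(w')` to `L^r(w)` and the inner one `L^r(w)` to `L^r(w')`, each
    -- with constant `1`; `T` acts on `L^r(w')` in between.
    have hp1 := weightedNorm_realSymbol_mul_le hr hwm hwm' b
      (T ⟨realSymbol b ((expMap g (-s) * v).comp ρ) * f, hq⟩)
      ((expMap g s * u).comp ρ) zero_le_one (by
        filter_upwards [hw.1.2] with x hx
        rw [Real.one_rpow, one_mul]
        exact mul_le_mul_of_nonneg_right (hval s u hu (b x)) hx.le)
    have hp2 := weightedNorm_realSymbol_mul_le hr hwm' hwm b f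
      ((expMap g (-s) * v).comp ρ) zero_le_one (by
        filter_upwards [hw.1.2] with x hx
        rw [Real.one_rpow, one_mul]
        refine (mul_le_mul_of_nonneg_right (hval (-s) v hv (b x)) (by positivity)).trans
          (le_of_eq ?_)
        rw [← mul_assoc, ← Real.exp_add]
        ring_nf
        simp)
    rw [ENNReal.ofReal_one, one_mul] at hp1 hp2
    obtain ⟨_, hTb⟩ := hT w' hw' _ (hp2.trans_lt hf)
    calc _ ≤ _ := hp1
      _ ≤ _ := hTb
      _ ≤ M := by rw [hM]; gcongr

end

/-! ### Removing the truncation -/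

noncomputable section
variable {d : ℕ} {𝕜 : Type*} [RCLike 𝕜] {r : ℝ} {w w' : (Fin d → ℝ) → ℝ}

theorem abs_sub_clamp_le {N : ℝ} (hN : 0 < N) (t : ℝ) : |t - clamp N t| ≤ t ^ 2 / N := by
  rw [le_div_iff₀ hN]
  rcases le_or_gt |t| N with h | h
  · rw [clamp_eq_self h, sub_self, abs_zero, zero_mul]
    positivity
  · have h1 : |t - clamp N t| ≤ |t| := by
      rcases lt_abs.1 h with h | h
      · rw [clamp, min_eq_right h.le, max_eq_right (by linarith), abs_of_pos (by linarith),
          abs_of_pos (by linarith)]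
        linarith
      · rw [clamp, min_eq_left (by linarith), max_eq_left (by linarith), abs_of_neg (by linarith),
          abs_of_neg (by linarith)]
        linarith
    calc _ ≤ |t| * |t| := by gcongr
      _ = t ^ 2 := by rw [← sq, sq_abs]

/-- The square of `x ≤ e^x` at `x = δ|t|/(2r)`. The `r`-th power of the exponential is `e^{δ|t|}`,
exactly what a damped weight compensates. -/
theorem sq_le_mul_exp_abs {δ : ℝ} (hr : 0 < r) (hδ : 0 < δ) (t : ℝ) :
    t ^ 2 ≤ (2 * r / δ) ^ 2 * Real.exp (δ * |t| / r) := by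
  set x := δ * |t| / (2 * r) with hx
  have h1 : x ≤ Real.exp x := by linarith [Real.add_one_le_exp x]
  have h2 : x ^ 2 ≤ Real.exp (δ * |t| / r) := by
    rw [show δ * |t| / r = x + x by rw [hx]; field_simp; ring, Real.exp_add, ← sq]
    have : 0 ≤ x := by positivity
    gcongr
  calc t ^ 2 = (2 * r / δ) ^ 2 * x ^ 2 := by
        rw [← sq_abs t, hx]; field_simp
    _ ≤ _ := by gcongr

/-- The part of a continuous function beyond the truncation to `[-N, N]`. -/
def clampTail (φ : C(𝕜, ℝ)) (N : ℝ) : C(𝕜, ℝ) := φ - clampMap φ N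

theorem weightedNorm_clampTail_mul_le (hr : 1 < r) (hw : IsWeight w)
    (b g : (Fin d → ℝ) →ₘ[volume] 𝕜) (φ : C(𝕜, ℝ)) {δ N : ℝ} (hδ : 0 < δ) (hN : 0 < N)
    (hw' : AEMeasurable (fun x => Real.exp (-δ * |φ (b x)|) * w x) volume) :
    weightedNorm r (fun x => Real.exp (-δ * |φ (b x)|) * w x) (realSymbol b (clampTail φ N) * g) ≤
      ENNReal.ofReal ((2 * r / δ) ^ 2 / N) * weightedNorm r w g := by
  have hr0 : 0 < r := by linarith
  refine weightedNorm_realSymbol_mul_le hr hw' (aemeasurable_of_isWeight hw) b g _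
    (by positivity) ?_
  filter_upwards [hw.2] with x hx
  set t := φ (b x)
  have h1 : |clampTail φ N (b x)| ≤ (2 * r / δ) ^ 2 / N * Real.exp (δ * |t| / r) :=
    (abs_sub_clamp_le hN t).trans (by
      rw [div_mul_eq_mul_div]
      gcongr
      exact sq_le_mul_exp_abs hr0 hδ t)
  calc _ ≤ ((2 * r / δ) ^ 2 / N * Real.exp (δ * |t| / r)) ^ r * (Real.exp (-δ * |t|) * w x) := by
        gcongr
    _ = _ := by
      rw [Real.mul_rpow (by positivity) (by positivity), ← Real.exp_mul, mul_assoc,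
        ← mul_assoc (Real.exp _), ← Real.exp_add, div_mul_cancel₀ _ hr0.ne']
      simp

theorem weightedNorm_mono (hr : 1 < r) (hw : AEMeasurable w volume) (hw' : AEMeasurable w' volume)
    (h : ∀ᵐ x, w x ≤ w' x) (g : (Fin d → ℝ) →ₘ[volume] 𝕜) :
    weightedNorm r w g ≤ weightedNorm r w' g := by
  have := weightedNorm_le_of_ae_le hr hw hw' (g := g) (g' := g) zero_le_one (by
    filter_upwards [h] with x hx
    rw [one_mul]
    gcongr)
  simpa using this

/-- Fatou's lemma along `δ₀ / (n + 1)`. -/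
theorem weightedNorm_le_of_forall_exp (hr : 1 < r) (hw : IsWeight w) {t : (Fin d → ℝ) → ℝ}
    (ht : AEMeasurable t volume) (g : (Fin d → ℝ) →ₘ[volume] 𝕜) {δ₀ : ℝ} (hδ₀ : 0 < δ₀) {R : ℝ≥0∞}
    (h : ∀ δ, 0 < δ → δ ≤ δ₀ → weightedNorm r (fun x => Real.exp (-δ * t x) * w x) g ≤ R) :
    weightedNorm r w g ≤ R := by
  have hr0 : 0 < r := by linarith
  have hwm := aemeasurable_of_isWeight hw
  let δ : ℕ → ℝ := fun n => δ₀ / (n + 1)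
  have hδ : ∀ n, 0 < δ n ∧ δ n ≤ δ₀ := fun n =>
    ⟨by positivity, div_le_self hδ₀.le (by linarith [(Nat.cast_nonneg n : (0 : ℝ) ≤ n)])⟩
  have hδlim : Filter.Tendsto δ Filter.atTop (nhds 0) := by
    have := (tendsto_one_div_add_atTop_nhds_zero_nat (𝕜 := ℝ)).const_mul δ₀
    rw [mul_zero] at this
    exact this.congr fun n => by simp only [δ]; ring
  have hm : ∀ n, AEMeasurable (fun x => Real.exp (-δ n * t x) * w x) volume := fun n => by fun_prop
  have hgm := g.aestronglyMeasurable.norm.aemeasurable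
  have hn : ∀ n, ∫⁻ x, ENNReal.ofReal (‖g x‖ ^ r * (Real.exp (-δ n * t x) * w x)) ≤ R ^ r := by
    intro n
    have := h (δ n) (hδ n).1 (hδ n).2
    rw [weightedNorm_eq_lintegral hr (hm n)] at this
    have h2 := ENNReal.rpow_le_rpow this hr0.le
    rwa [← ENNReal.rpow_mul, one_div_mul_cancel hr0.ne', ENNReal.rpow_one] at h2
  have hlim : ∀ x, Filter.Tendsto (fun n => ENNReal.ofReal
      (‖g x‖ ^ r * (Real.exp (-δ n * t x) * w x))) Filter.atTop
      (nhds (ENNReal.ofReal (‖g x‖ ^ r * w x))) := by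
    intro x
    refine ENNReal.tendsto_ofReal (Filter.Tendsto.const_mul _ ?_)
    have h1 : Filter.Tendsto (fun n => Real.exp (-δ n * t x)) Filter.atTop (nhds 1) := by
      have := (Real.continuous_exp.tendsto _).comp ((hδlim.neg).mul_const (t x))
      simpa [Function.comp_def] using this
    simpa using h1.mul_const (w x)
  rw [weightedNorm_eq_lintegral hr hwm]
  have hfin : ∫⁻ x, ENNReal.ofReal (‖g x‖ ^ r * w x) ≤ R ^ r := by
    calc _ = ∫⁻ x, Filter.liminf (fun n => ENNReal.ofReal
        (‖g x‖ ^ r * (Real.exp (-δ n * t x) * w x))) Filter.atTop :=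
          lintegral_congr fun x => (hlim x).liminf_eq.symm
      _ ≤ _ := lintegral_liminf_le' fun n => by
        have := hm n
        fun_prop
      _ ≤ _ := (Filter.liminf_le_liminf (Filter.Eventually.of_forall hn)).trans
          (Filter.liminf_const _).le
  refine (ENNReal.rpow_le_rpow hfin (by positivity)).trans (le_of_eq ?_)
  rw [← ENNReal.rpow_mul, mul_one_div_cancel hr0.ne', ENNReal.rpow_one]

/-- The commutator estimate for a real-valued symbol. -/
theorem HasMuckenhouptBound.real_commutator_le (hr : 1 < r) {α : ℝ} {C₀ : ℝ≥0}
    {T : ((Fin d → ℝ) →ₘ[volume] 𝕜) →ₗ.[𝕜] ((Fin d → ℝ) →ₘ[volume] 𝕜)}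
    (hT : HasMuckenhouptBound T r α C₀) (hw : IsMuckenhoupt r w)
    (b f : (Fin d → ℝ) →ₘ[volume] 𝕜) (hf : weightedNorm r w f < ∞) {φ : C(𝕜, ℝ)}
    (hφ : LipschitzWith 1 φ) {B : ℝ} (hB : 0 < B) (hb : LocallyIntegrable b volume)
    (hosc : ∀ (a : Fin d → ℝ) (ℓ : ℝ), 0 < ℓ →
      ∃ c : 𝕜, ∫ x in halfOpenCube a ℓ, ‖b x - c‖ ≤ B * ℓ ^ d) :
    ∃ (hf' : f ∈ T.domain) (hbf : realSymbol b φ * f ∈ T.domain),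
      weightedNorm r w (realSymbol b φ * T ⟨f, hf'⟩ - T ⟨realSymbol b φ * f, hbf⟩) ≤
      transferConstant d r α C₀ * ENNReal.ofReal (2 * B) *
        muckenhouptChar r w ^ (α + transferExponent r) * weightedNorm r w f := by
  have hr0 : 0 < r := by linarith
  have hA1 := one_le_toReal_muckenhouptChar hr hw
  have hκ := perturbationConstant_pos d r
  have hwm := aemeasurable_of_isWeight hw.1
  obtain ⟨hf', hTf⟩ := hT w hw f hf
  have hA0 : muckenhouptChar r w ≠ 0 := (one_pos.trans_le (one_le_muckenhouptChar hr hw.1)).ne'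
  have hTf' : weightedNorm r w (T ⟨f, hf'⟩) < ∞ := hTf.trans_lt
    (ENNReal.mul_lt_top (ENNReal.mul_lt_top ENNReal.coe_lt_top
      (ENNReal.rpow_ne_top_of_ne_zero hA0 hw.2.ne).lt_top) hf)
  have hclamp := fun (n : ℝ) (hn : 0 ≤ n) => hT.clamp_commutator_le hr hw b f hf
    (φ := φ) (B := 2 * B) (N := n) (by positivity) hn
    (HasOscBound.of_lipschitz hb hosc (φ := fun z => clamp n (φ z))
      (by have := (lipschitzWith_clamp n).comp hφ; rwa [one_mul] at this))
  set R := transferConstant d r α C₀ * ENNReal.ofReal (2 * B) *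
        muckenhouptChar r w ^ (α + transferExponent r) * weightedNorm r w f
  have habs : HasOscBound (fun x => |φ (b x)|) (2 * B) :=
    HasOscBound.of_lipschitz hb hosc (φ := fun z => |φ z|)
      (by have := (lipschitzWith_one_norm (E := ℝ)).comp hφ; rwa [one_mul] at this)
  -- The function `|φ ∘ b|` has bounded mean oscillation as well, so the damped weights stay in
  -- `A_r`.
  have hpert : ∀ δ, 0 < δ →
      δ ≤ perturbationConstant d r * (muckenhouptChar r w).toReal ^ (-transferExponent r) / (2 * B)
      → IsMuckenhoupt r (fun x => Real.exp (-δ * |φ (b x)|) * w x) := fun δ hδ hδ' =>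
    (hw.exp_mul hr (by positivity) habs (by
      rwa [abs_neg, abs_of_pos hδ, ← le_div_iff₀ (by positivity)])).1
  set δ₀ := perturbationConstant d r * (muckenhouptChar r w).toReal ^ (-transferExponent r) /
    (2 * B)
  have hδ₀ : 0 < δ₀ := by positivity
  have hsplit : ∀ (n : ℝ) (g : (Fin d → ℝ) →ₘ[volume] 𝕜), realSymbol b φ * g =
      realSymbol b (clampMap φ n) * g + realSymbol b (clampTail φ n) * g := fun n g => by
    rw [← aeEqFun_add_mul, ← realSymbol_add, clampTail, add_sub_cancel]
  have htail : ∀ δ, 0 < δ → δ ≤ δ₀ → ∀ n : ℝ, 0 < n →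
      ∃ hdom : realSymbol b (clampTail φ n) * f ∈ T.domain,
      weightedNorm r (fun x => Real.exp (-δ * |φ (b x)|) * w x)
        (T ⟨realSymbol b (clampTail φ n) * f, hdom⟩) ≤
      C₀ * muckenhouptChar r (fun x => Real.exp (-δ * |φ (b x)|) * w x) ^ α *
        (ENNReal.ofReal ((2 * r / δ) ^ 2 / n) * weightedNorm r w f) := by
    intro δ hδ hδ' n hn
    have hw' := hpert δ hδ hδ'
    have h1 := weightedNorm_clampTail_mul_le hr hw.1 b f φ hδ hn (aemeasurable_of_isWeight hw'.1)
    obtain ⟨h2, h3⟩ := hT _ hw' _ (h1.trans_lt (ENNReal.mul_lt_top ENNReal.ofReal_lt_top hf))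
    exact ⟨h2, h3.trans (by gcongr)⟩
  -- The product need not lie in `L^r(w)`, but it is the sum of a truncated part in the domain and a
  -- tail in a damped space.
  have hbf : realSymbol b φ * f ∈ T.domain := by
    rw [hsplit 1]
    exact T.domain.add_mem (hclamp 1 zero_le_one).2.1 (htail δ₀ hδ₀ le_rfl 1 one_pos).1
  refine ⟨hf', hbf, ?_⟩
  refine weightedNorm_le_of_forall_exp hr hw.1 (t := fun x => |φ (b x)|)
    habs.1.aestronglyMeasurable.aemeasurable _ hδ₀ fun δ hδ hδ' => ?_
  have hw' := hpert δ hδ hδ'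
  have hwm' := aemeasurable_of_isWeight hw'.1
  have htop : C₀ * muckenhouptChar r (fun x => Real.exp (-δ * |φ (b x)|) * w x) ^ α ≠ ∞ :=
    ENNReal.mul_ne_top ENNReal.coe_ne_top (ENNReal.rpow_ne_top_of_ne_zero
      (one_pos.trans_le (one_le_muckenhouptChar hr hw'.1)).ne' hw'.2.ne)
  set w' := fun x => Real.exp (-δ * |φ (b x)|) * w x
  set D := C₀ * muckenhouptChar r w' ^ α
  have hle : ∀ᵐ x, w' x ≤ w x := by
    filter_upwards [hw.1.2] with x hx
    refine mul_le_of_le_one_left hx.le (Real.exp_le_one_iff.2 ?_)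
    have := mul_nonneg hδ.le (abs_nonneg (φ (b x)))
    linarith
  set E := weightedNorm r w (T ⟨f, hf'⟩) + D * weightedNorm r w f
  have hE : E ≠ ∞ := ENNReal.add_ne_top.2 ⟨hTf'.ne, ENNReal.mul_ne_top htop hf.ne⟩
  -- For fixed `δ`, `E` is finite but may blow up as `δ → 0`. The limit in `n` is therefore taken
  -- first and leaves `R`, which does not involve `δ`.
  have hbound : ∀ n : ℕ, weightedNorm r w' (realSymbol b φ * T ⟨f, hf'⟩ -
      T ⟨realSymbol b φ * f, hbf⟩) ≤
      R + ENNReal.ofReal ((2 * r / δ) ^ 2 / (n + 1 : ℝ)) * E := by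
    intro n
    have hn : (0 : ℝ) < n + 1 := by positivity
    obtain ⟨_, hd2, h2⟩ := hclamp (n + 1) hn.le
    obtain ⟨hd3, h3⟩ := htail δ hδ hδ' (n + 1) hn
    have h4 := weightedNorm_clampTail_mul_le hr hw.1 b (T ⟨f, hf'⟩) φ hδ hn hwm'
    rw [T.apply_add_of_eq hbf hd2 hd3 (hsplit _ _), hsplit (n + 1), add_sub_add_comm]
    refine (weightedNorm_add_le hr _ _).trans (add_le_add ?_ ?_)
    · exact (weightedNorm_mono hr hwm' hwm hle _).trans h2
    · refine (weightedNorm_sub_le hr _ _).trans ((add_le_add h4 h3).trans (le_of_eq ?_))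
      ring
  have hlim : Filter.Tendsto (fun n : ℕ => R + ENNReal.ofReal ((2 * r / δ) ^ 2 / (n + 1 : ℝ)) * E)
      Filter.atTop (nhds (R + ENNReal.ofReal 0 * E)) := by
    refine Filter.Tendsto.const_add _ (ENNReal.Tendsto.mul_const (ENNReal.tendsto_ofReal ?_)
      (Or.inr hE))
    have := (tendsto_one_div_add_atTop_nhds_zero_nat (𝕜 := ℝ)).const_mul ((2 * r / δ) ^ 2)
    rw [mul_zero] at this
    exact this.congr fun n => by ring
  rw [ENNReal.ofReal_zero, zero_mul, add_zero] at hlim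
  exact ge_of_tendsto' hlim hbound

end

/-! ### Real and imaginary parts, and conclusion -/

noncomputable section
variable {d : ℕ} {𝕜 : Type*} [RCLike 𝕜] {r : ℝ} {w w' : (Fin d → ℝ) → ℝ}

theorem exists_setIntegral_norm_sub_le {b : (Fin d → ℝ) →ₘ[volume] 𝕜}
    (hb : LocallyIntegrable b volume) {B : ℝ} (hB : 0 < B) (h : bmoNorm b ≤ ENNReal.ofReal B)
    (a : Fin d → ℝ) (ℓ : ℝ) (hℓ : 0 < ℓ) :
    ∃ c : 𝕜, ∫ x in halfOpenCube a ℓ, ‖b x - c‖ ≤ B * ℓ ^ d := by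
  refine ⟨⨍ y in axisCube a ℓ, b y, ?_⟩
  set c := ⨍ y in axisCube a ℓ, b y
  have h1 : ⨍⁻ x in axisCube a ℓ, ‖b x - c‖ₑ ∂volume ≤ ENNReal.ofReal B := by
    refine le_trans ?_ h
    exact le_iSup_of_le a (le_iSup_of_le ℓ (le_iSup_of_le hℓ le_rfl))
  rw [setLAverage_eq, ← setLIntegral_congr (halfOpenCube_ae_eq a ℓ),
    ← measure_congr (halfOpenCube_ae_eq a ℓ),
    ENNReal.div_le_iff (volume_halfOpenCube_ne_zero a hℓ) (volume_halfOpenCube_ne_top a ℓ)] at h1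
  have hm : AEStronglyMeasurable (fun x => b x - c) (volume.restrict (halfOpenCube a ℓ)) :=
    (hb.aestronglyMeasurable.sub aestronglyMeasurable_const).restrict
  rw [integral_norm_eq_lintegral_enorm hm]
  refine (ENNReal.toReal_mono (ENNReal.mul_ne_top ENNReal.ofReal_ne_top
    (volume_halfOpenCube_ne_top a ℓ)) h1).trans (le_of_eq ?_)
  rw [ENNReal.toReal_mul, ENNReal.toReal_ofReal hB.le]
  congr 1
  exact volumeReal_halfOpenCube a hℓ

/-- The real part as a continuous function. -/
def rclikeRe (𝕜 : Type*) [RCLike 𝕜] : C(𝕜, ℝ) := ⟨RCLike.re, RCLike.continuous_re⟩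

/-- The imaginary part as a continuous function. -/
def rclikeIm (𝕜 : Type*) [RCLike 𝕜] : C(𝕜, ℝ) := ⟨RCLike.im, RCLike.continuous_im⟩

theorem lipschitzWith_rclikeRe : LipschitzWith 1 (rclikeRe 𝕜) :=
  LipschitzWith.of_dist_le_mul fun x y => by
    rw [NNReal.coe_one, one_mul, Real.dist_eq, dist_eq_norm]
    have := RCLike.abs_re_le_norm (x - y)
    rwa [map_sub] at this

theorem lipschitzWith_rclikeIm : LipschitzWith 1 (rclikeIm 𝕜) :=
  LipschitzWith.of_dist_le_mul fun x y => by
    rw [NNReal.coe_one, one_mul, Real.dist_eq, dist_eq_norm]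
    have := RCLike.abs_im_le_norm (x - y)
    rwa [map_sub] at this

theorem eq_realSymbol_add (b : (Fin d → ℝ) →ₘ[volume] 𝕜) :
    b = realSymbol b (rclikeRe 𝕜) + (RCLike.I : 𝕜) • realSymbol b (rclikeIm 𝕜) := by
  refine AEEqFun.ext ?_
  filter_upwards [AEEqFun.coeFn_add (realSymbol b (rclikeRe 𝕜))
    ((RCLike.I : 𝕜) • realSymbol b (rclikeIm 𝕜)),
    AEEqFun.coeFn_smul (RCLike.I : 𝕜) (realSymbol b (rclikeIm 𝕜)),
    coeFn_realSymbol b (rclikeRe 𝕜), coeFn_realSymbol b (rclikeIm 𝕜)] with x h1 h2 h3 h4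
  rw [h1, Pi.add_apply, h2, Pi.smul_apply, h3, h4, smul_eq_mul, mul_comm]
  exact (RCLike.re_add_im (b x)).symm

theorem weightedNorm_smul_le (hr : 1 < r) (hw : IsWeight w) {c : 𝕜} (hc : ‖c‖ ≤ 1)
    (g : (Fin d → ℝ) →ₘ[volume] 𝕜) : weightedNorm r w (c • g) ≤ weightedNorm r w g := by
  have hwm := aemeasurable_of_isWeight hw
  have := weightedNorm_le_of_ae_le hr hwm hwm (g := c • g) (g' := g) zero_le_one (by
    filter_upwards [hw.2, AEEqFun.coeFn_smul c g] with x hx h1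
    rw [h1, Pi.smul_apply, norm_smul]
    gcongr)
  simpa using this

/-- Only an inequality, since `RCLike.I` vanishes over the reals. -/
theorem norm_rclikeI_le_one : ‖(RCLike.I : 𝕜)‖ ≤ 1 := by
  by_cases h : (RCLike.I : 𝕜) = 0
  · simp [h]
  · exact (RCLike.norm_I_of_ne_zero h).le

/-- The real and imaginary parts are `1`-Lipschitz images of `b`; each contributes `2 * B`, whence
the factor `4`. -/
theorem HasMuckenhouptBound.commutator_le (hr : 1 < r) {α : ℝ} {C₀ : ℝ≥0}
    {T : ((Fin d → ℝ) →ₘ[volume] 𝕜) →ₗ.[𝕜] ((Fin d → ℝ) →ₘ[volume] 𝕜)}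
    (hT : HasMuckenhouptBound T r α C₀) (hw : IsMuckenhoupt r w)
    (b f : (Fin d → ℝ) →ₘ[volume] 𝕜) (hf : weightedNorm r w f < ∞) {B : ℝ} (hB : 0 < B)
    (hb : LocallyIntegrable b volume) (hbB : bmoNorm b ≤ ENNReal.ofReal B) :
    ∃ hf' : f ∈ (mulCommutator b T).domain,
      weightedNorm r w (mulCommutator b T ⟨f, hf'⟩) ≤
      4 * transferConstant d r α C₀ * ENNReal.ofReal B *
        (muckenhouptChar r w ^ (α + transferExponent r) * weightedNorm r w f) := by
  have hosc := exists_setIntegral_norm_sub_le hb hB hbB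
  obtain ⟨hf', hre, h1⟩ := hT.real_commutator_le hr hw b f hf (lipschitzWith_rclikeRe (𝕜 := 𝕜)) hB
    hb hosc
  obtain ⟨_, him, h2⟩ := hT.real_commutator_le hr hw b f hf (lipschitzWith_rclikeIm (𝕜 := 𝕜)) hB
    hb hosc
  set u := realSymbol b (rclikeRe 𝕜)
  set v := realSymbol b (rclikeIm 𝕜)
  have hbuv : b = u + (RCLike.I : 𝕜) • v := eq_realSymbol_add b
  have hmul : ∀ g, b * g = u * g + (RCLike.I : 𝕜) • (v * g) := fun g => by
    conv_lhs => rw [hbuv]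
    rw [aeEqFun_add_mul, aeEqFun_smul_mul]
  have him' : (RCLike.I : 𝕜) • (v * f) ∈ T.domain := T.domain.smul_mem _ him
  have hbf : b * f ∈ T.domain := by
    rw [hmul]
    exact T.domain.add_mem hre him'
  refine ⟨⟨hf', hbf⟩, ?_⟩
  have hsub : ∀ g₁ g₂ : (Fin d → ℝ) →ₘ[volume] 𝕜,
      (RCLike.I : 𝕜) • g₁ - (RCLike.I : 𝕜) • g₂ = (RCLike.I : 𝕜) • (g₁ - g₂) :=
    fun g₁ g₂ => (smul_sub _ _ _).symm
  have hval : mulCommutator b T ⟨f, ⟨hf', hbf⟩⟩ = b * T ⟨f, hf'⟩ - T ⟨b * f, hbf⟩ := rfl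
  rw [hval, T.apply_add_of_eq hbf hre him' (hmul f),
    T.apply_smul_of_eq him' him RCLike.I rfl, hmul, add_sub_add_comm, hsub]
  refine (weightedNorm_add_le hr _ _).trans ((add_le_add h1
    ((weightedNorm_smul_le hr hw.1 norm_rclikeI_le_one _).trans h2)).trans (le_of_eq ?_))
  rw [ENNReal.ofReal_mul (by norm_num), ENNReal.ofReal_ofNat]
  ring

theorem transferConstant_ne_top (d : ℕ) {r : ℝ} (hr : 1 < r) (α : ℝ) (C₀ : ℝ≥0) :
    transferConstant d r α C₀ ≠ ∞ := by
  have : 0 ≤ r * |α| := mul_nonneg (by linarith) (abs_nonneg _)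
  exact ENNReal.mul_ne_top ENNReal.ofReal_ne_top (ENNReal.mul_ne_top ENNReal.coe_ne_top
    (ENNReal.rpow_ne_top_of_nonneg this (by norm_num)))

end

theorem mainTheorem3 {𝕜 : Type*} [RCLike 𝕜] (d : ℕ) (hd : 1 ≤ d) (r : ℝ) (hr : 1 < r) (α : ℝ)
    (T : ((Fin d → ℝ) →ₘ[volume] 𝕜) →ₗ.[𝕜] ((Fin d → ℝ) →ₘ[volume] 𝕜))
    (hT : ∃ C₀ : ℝ≥0, HasMuckenhouptBound T r α C₀) :
    ∃ C : ℝ≥0, ∀ b : (Fin d → ℝ) →ₘ[volume] 𝕜, IsBMO b →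
      HasMuckenhouptBound (mulCommutator b T) r (α + max 1 (1 / (r - 1))) (C * bmoNorm b) := by
  obtain ⟨C₀, hT⟩ := hT
  have hCt : 4 * transferConstant d r α C₀ ≠ ∞ :=
    ENNReal.mul_ne_top (by norm_num) (transferConstant_ne_top d hr α C₀)
  refine ⟨(4 * transferConstant d r α C₀).toNNReal, fun b hb w hw f hf => ?_⟩
  -- The estimate needs a positive `B`, so the norm is approached from above; this includes symbols
  -- of norm zero.
  have hbound := fun n : ℕ => hT.commutator_le hr hw b f hf
    (B := (bmoNorm b).toReal + 1 / ((n : ℝ) + 1)) (by positivity) hb.1 (by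
      rw [ENNReal.ofReal_add ENNReal.toReal_nonneg (by positivity), ENNReal.ofReal_toReal hb.2.ne]
      exact le_self_add)
  obtain ⟨hf', -⟩ := hbound 0
  refine ⟨hf', ?_⟩
  rw [ENNReal.coe_toNNReal hCt, mul_assoc (_ * bmoNorm b)]
  have hA0 : muckenhouptChar r w ≠ 0 := (one_pos.trans_le (one_le_muckenhouptChar hr hw.1)).ne'
  have hlim : Filter.Tendsto (fun n : ℕ => 4 * transferConstant d r α C₀ *
      ENNReal.ofReal ((bmoNorm b).toReal + 1 / ((n : ℝ) + 1)) *
        (muckenhouptChar r w ^ (α + transferExponent r) * weightedNorm r w f)) Filter.atTop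
      (nhds (4 * transferConstant d r α C₀ * ENNReal.ofReal ((bmoNorm b).toReal + 0) *
        (muckenhouptChar r w ^ (α + transferExponent r) * weightedNorm r w f))) := by
    refine ENNReal.Tendsto.mul_const (ENNReal.Tendsto.const_mul (ENNReal.tendsto_ofReal
      (tendsto_one_div_add_atTop_nhds_zero_nat.const_add _)) (Or.inr hCt)) (Or.inr ?_)
    exact ENNReal.mul_ne_top (ENNReal.rpow_ne_top_of_ne_zero hA0 hw.2.ne) hf.ne
  rw [add_zero, ENNReal.ofReal_toReal hb.2.ne] at hlim
  exact ge_of_tendsto' hlim fun n => (hbound n).2
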